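/- For $\tau$ in the upper half plane $\mathcal H$ write $q^s=e^{2\pi i s\tau}$, let $\eta(\tau)=q^{1/24}\prod_{n\ge1}(1-q^n)$ be the Dedekind eta function, and for $h>0$ put $f^{\langle h\rangle}(\tau)=f(h\tau)$. Put $$f^\flat=\frac{(f^{\langle 1/2\rangle})^2}{f},\qquad f^\sharp=\frac{(f^{\langle 2\rangle})^2}{f},\qquad f^\natural=\frac{f^5}{(f^{\langle 1/2\rangle})^2(f^{\langle 2\rangle})^2},$$ and $[\eta,\tfrac c4](\tau)=\eta^\natural\big(\tfrac{\tau+c}4\big)$ for odd $c$. For a function $f$ on $\mathcal H$ let $\sqrt f$ denote its normalized square root: the (unique) holomorphic $g$ on $\mathcal H$ with $g^2=f$ and $g/q^{s}\to1$ as $\operatorname{Im}\tau\to\infty$ for some real $s$. Multipliers. For $\gamma=\begin{pmatrix}a&b\\c&d\end{pmatrix}\in\Gamma_0(2)\cap\Gamma^0(2)$ (that is, $\gamma\in SL_2(\mathbb Z)$ with $b,c$ even) put $b_N(\gamma)=e^{2\pi i bd/N}$, $c_N(\gamma)=e^{-2\pi i cd/N}$, let $\chi_{16}(\gamma)=\chi_{16}(d)$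 for the even Dirichlet character modulo $16$ with $\chi_{16}(5)=i$, and let $\xi_8(d)=e^{2\pi i(d-1)/8}$. Let $$J_{\frac12^*}(\gamma,\tau)=\Big(\frac cd\Big)\sqrt{c\tau+d}\;\xi_8(d)$$ (Kronecker symbol, principal root), and define $J_{\frac34^*}$, $J_{\frac34^*+\frac{\mathfrak a}2}$, $J_{\frac34^*+\frac{\mathfrak A}2}$ (formal symbols $\mathfrak a=\langle\frac12\rangle$, $\mathfrak A=\langle2\rangle$) as the unique factors with $$g(\gamma\tau)=\chi(\gamma)J(\gamma,\tau)g(\tau)\quad\text{for}\quad (g,\chi)=\big(\sqrt{\eta^3},\,c_{16}b_{16}\big),\ \big(\sqrt{(\eta^{\langle1/2\rangle})^3},\,\overline{\chi_{16}}c_8b_{32}\big),\ \big(\sqrt{(\eta^{\langle2\rangle})^3},\,\chi_{16}c_{32}b_8\big)$$ respectively. The factor of weight $\kappa=\frac12^*+\frac{\mathfrak a+\mathfrak A}2$ is $J_\kappa=J_{\frac12^*}\,J_{\frac34^*+\frac{\mathfrak a}2}\,J_{\frac34^*+\frac{\mathfrak A}2}\,/\,J_{\frac34^*}^2$. For $\varGamma\subset\Gamma_0(2)\cap\Gamma^0(2)$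 and $\chi:\varGamma\to\mathbb C^\times$ let $\mathcal M(\varGamma)_{(\kappa,\chi)}$ be the space of holomorphic $f$ on $\mathcal H$ with $f(\gamma\tau)=\chi(\gamma)J_\kappa(\gamma,\tau)f(\tau)$ for all $\gamma\in\varGamma$, such that for every $\alpha=\begin{pmatrix}*&*\\c&d\end{pmatrix}\in SL_2(\mathbb Z)$ the function $f(\alpha\tau)/\sqrt{c\tau+d}$ is bounded as $\operatorname{Im}\tau\to\infty$. Put $\mathcal M(\varGamma)_\kappa=\mathcal M(\varGamma)_{(\kappa,1)}$ and $\varGamma_4=\Gamma_0(4)\cap\Gamma^0(4)$ (that is, $4\mid b$ and $4\mid c$). Proposition. The three normalized square roots below exist, and $$\sqrt{[\eta,\tfrac74]\,[\eta,\tfrac14]}=\sqrt{\eta^{\natural\langle1/2\rangle}\,\eta^{\natural\langle2\rangle}}+\sqrt2\,\sqrt{\eta^{\flat\langle1/2\rangle}\,\eta^{\sharp\langle2\rangle}}$$ on $\mathcal H$. Moreover, with $\kappa=\frac12^*+\frac{\mathfrak a+\mathfrak A}2$, $$\sqrt{\eta^{\natural\langle1/2\rangle}\eta^{\natural\langle2\rangle}}\in\mathcal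 M(\varGamma_4)_{\kappa},\qquad \sqrt{\eta^{\flat\langle1/2\rangle}\eta^{\sharp\langle2\rangle}}\in\mathcal M(\varGamma_4)_{(\kappa,\,c_8b_8)},$$ so the identity holds in $\mathcal M\big(\{\gamma\in\varGamma_4 : c_8b_8(\gamma)=1\}\big)_{\kappa}$; in particular $\sqrt{[\eta,\frac74][\eta,\frac14]}$ lies in this space. -/

import Mathlib

open UpperHalfPlane Filter Topology
open scoped MatrixGroups Manifold

noncomputable section

namespace EtaForms

/-! ### Operations on functions on the upper half plane -/

/-- `q ^ s = exp (2 π i s τ)` for a real exponent `s`. -/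
def qPow (s : ℝ) (τ : ℍ) : ℂ := Complex.exp (2 * Real.pi * Complex.I * s * τ)

/-- Rescaling `f^⟨h⟩ (τ) = f (h τ)` by a positive real number `h`. -/
def rescale (h : ℝ) (f : ℍ → ℂ) (hh : 0 < h := by norm_num) : ℍ → ℂ :=
  fun τ => f ((⟨h, hh⟩ : {x : ℝ // 0 < x}) • τ)

/-- Translation `(f | (1 c; 0 1)) (τ) = f (τ + c)`. -/
def translate (c : ℤ) (f : ℍ → ℂ) : ℍ → ℂ := fun τ => f ((c : ℝ) +ᵥ τ)

/-- `f^♭ = (f^⟨1/2⟩)² / f`. -/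
def flat (f : ℍ → ℂ) : ℍ → ℂ := rescale (1 / 2) f ^ 2 / f

/-- `f^♯ = (f^⟨2⟩)² / f`. -/
def sharp (f : ℍ → ℂ) : ℍ → ℂ := rescale 2 f ^ 2 / f

/-- `f^♮ = f⁵ / ((f^⟨1/2⟩)² (f^⟨2⟩)²)`. -/
def natural (f : ℍ → ℂ) : ℍ → ℂ := f ^ 5 / (rescale (1 / 2) f ^ 2 * rescale 2 f ^ 2)

/-- The Dedekind eta function on the upper half plane. -/
def eta : ℍ → ℂ := fun τ => ModularForm.eta τ

/-- The form `[η, c/4] = η^♮⟨1/4⟩ | (1 c; 0 1)`, that is `τ ↦ η^♮ ((τ + c) / 4)`. -/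
def etaQuarter (c : ℤ) : ℍ → ℂ := translate c (rescale (1 / 4) (natural eta))

/-! ### Normalized square roots -/

/-- `g` is the normalized square root of `f`: it is holomorphic on the upper half plane,
`g² = f`, and the leading term of its `q`-expansion is `q ^ s` with coefficient `1`. -/
def IsNormSqrt (f g : ℍ → ℂ) : Prop :=
  MDifferentiable 𝓘(ℂ) 𝓘(ℂ) g ∧ (∀ τ, g τ ^ 2 = f τ) ∧
    ∃ s : ℝ, Tendsto (fun τ => g τ / qPow s τ) atImInfty (𝓝 1)

open Classical in
/-- The normalized square root `√f` of a form `f` (with the value `0` if there is none).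
Note that this is a holomorphic function, in general different from the principal square
root of the value `f τ`. -/
def formSqrt (f : ℍ → ℂ) : ℍ → ℂ := if h : ∃ g, IsNormSqrt f g then h.choose else 0

lemma isNormSqrt_formSqrt {f g : ℍ → ℂ} (h : IsNormSqrt f g) : IsNormSqrt f (formSqrt f) := by
  have h' : ∃ g, IsNormSqrt f g := ⟨g, h⟩
  simpa only [formSqrt, dif_pos h'] using h'.choose_spec

/-- Normalized square roots are unique. -/
lemma IsNormSqrt.unique {f g h : ℍ → ℂ} (hg : IsNormSqrt f g) (hh : IsNormSqrt f h) : g = h := by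
  obtain ⟨gd, gsq, s, gs⟩ := hg
  obtain ⟨hd, hsq, t, ht⟩ := hh
  have q0 : ∀ (s : ℝ) (τ : ℍ), qPow s τ ≠ 0 := fun s τ => Complex.exp_ne_zero _
  have qn : ∀ (s : ℝ) (τ : ℍ), ‖qPow s τ‖ = Real.exp (-(2 * Real.pi * s) * τ.im) := by
    intro s τ
    rw [qPow, Complex.norm_exp]
    congr 1
    simp
  have nn : ∀ τ, ‖g τ‖ = ‖h τ‖ := by
    intro τ
    have := congrArg norm ((gsq τ).trans (hsq τ).symm)
    rw [norm_pow, norm_pow] at this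
    exact (pow_left_inj₀ (norm_nonneg _) (norm_nonneg _) two_ne_zero).1 this
  have im_top : Tendsto UpperHalfPlane.im atImInfty atTop := tendsto_comap
  have key : Tendsto (fun τ : ℍ => Real.exp (-(2 * Real.pi * (s - t)) * τ.im)) atImInfty (𝓝 1) := by
    have h1 := (ht.norm).div (gs.norm) (by simp)
    simp only [norm_one, div_one] at h1
    refine h1.congr' ?_
    have h2 : ∀ᶠ τ in atImInfty, g τ / qPow s τ ≠ 0 := gs.eventually_ne one_ne_zero
    filter_upwards [h2] with τ h2
    have g0 : ‖h τ‖ ≠ 0 := by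
      rw [← nn]
      intro h0
      exact h2 (by simp [norm_eq_zero.1 h0])
    have e1 := Real.exp_ne_zero (-(2 * Real.pi * s) * τ.im)
    have e2 := Real.exp_ne_zero (-(2 * Real.pi * t) * τ.im)
    simp only [Pi.div_apply, norm_div, qn, nn]
    rw [show -(2 * Real.pi * (s - t)) * τ.im
      = -(2 * Real.pi * s) * τ.im - -(2 * Real.pi * t) * τ.im by ring, Real.exp_sub]
    field_simp
  have hst : s = t := by
    rcases lt_trichotomy s t with hlt | heq | hgt
    · exfalso
      have : Tendsto (fun τ : ℍ => Real.exp (-(2 * Real.pi * (s - t)) * τ.im)) atImInfty atTop :=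
        Real.tendsto_exp_atTop.comp
          (im_top.const_mul_atTop (by nlinarith [Real.pi_pos, mul_pos Real.pi_pos (sub_pos.2 hlt)]))
      exact not_tendsto_nhds_of_tendsto_atTop this 1 key
    · exact heq
    · exfalso
      have : Tendsto (fun τ : ℍ => Real.exp (-(2 * Real.pi * (s - t)) * τ.im)) atImInfty (𝓝 0) :=
        Real.tendsto_exp_atBot.comp
          (im_top.const_mul_atTop_of_neg
            (by nlinarith [Real.pi_pos, mul_pos Real.pi_pos (sub_pos.2 hgt)]))
      exact zero_ne_one (tendsto_nhds_unique this key)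
  subst hst
  have ev : ∀ᶠ τ in atImInfty, g τ = h τ := by
    have h2 : ∀ᶠ τ in atImInfty, g τ / qPow s τ + h τ / qPow s τ ≠ 0 :=
      (gs.add ht).eventually_ne (by norm_num)
    filter_upwards [h2] with τ h2
    rcases sq_eq_sq_iff_eq_or_eq_neg.1 ((gsq τ).trans (hsq τ).symm) with h3 | h3
    · exact h3
    · exact absurd (by rw [h3]; ring) h2
  obtain ⟨A, hA⟩ := (atImInfty_mem _).1 ev
  rw [UpperHalfPlane.mdifferentiable_iff] at gd hd
  have ho : IsOpen {z : ℂ | 0 < z.im} := isOpen_lt continuous_const Complex.continuous_im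
  have hc : IsPreconnected {z : ℂ | 0 < z.im} := (convex_halfSpace_im_gt 0).isPreconnected
  set z₀ : ℂ := ((|A| + 1 : ℝ) : ℂ) * Complex.I with hz₀
  have hz : z₀.im = |A| + 1 := by simp [hz₀]
  have hev : (g ∘ ofComplex) =ᶠ[𝓝 z₀] (h ∘ ofComplex) := by
    have : ∀ᶠ z : ℂ in 𝓝 z₀, |A| < z.im :=
      Complex.continuous_im.continuousAt.eventually (lt_mem_nhds (by rw [hz]; linarith))
    filter_upwards [this] with z hz
    have hz' : 0 < z.im := (abs_nonneg A).trans_lt hz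
    simp only [Function.comp_apply, ofComplex_apply_of_im_pos hz']
    exact hA _ ((le_abs_self A).trans hz.le)
  have := (gd.analyticOnNhd ho).eqOn_of_preconnected_of_eventuallyEq (hd.analyticOnNhd ho) hc
    (show z₀ ∈ {z : ℂ | 0 < z.im} by
      change 0 < z₀.im
      rw [hz]
      positivity) hev
  funext τ
  simpa using this τ.im_pos

/-! ### Characters and multipliers -/

/-- The Kronecker symbol `(c / d)` for odd `d`
(with `(c / -1) = 1` for `c ≥ 0` and `(c / -1) = -1` for `c < 0`). -/
def kroneckerOdd (c d : ℤ) : ℤ :=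
  (if c < 0 ∧ d < 0 then -1 else 1) * jacobiSym c d.natAbs

/-- The map `√χ₄` on odd integers: `1` if `d ≡ 1 mod 4`, and `i` if `d ≡ -1 mod 4`. -/
def sqrtChi4 (d : ℤ) : ℂ := if d % 4 = 1 then 1 else Complex.I

/-- The map `ξ₈ = conj (√χ₄) · χ₈` on odd integers. -/
def xi8 (d : ℤ) : ℂ := (starRingEnd ℂ) (sqrtChi4 d) * (ZMod.χ₈ (d : ZMod 8) : ℤ)

/-- The even Dirichlet character `χ₁₆` modulo `16` with `χ₁₆ 5 = i`. -/
def chi16 (d : ℤ) : ℂ :=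
  if d % 16 = 1 ∨ d % 16 = 15 then 1
  else if d % 16 = 5 ∨ d % 16 = 11 then Complex.I
  else if d % 16 = 7 ∨ d % 16 = 9 then -1
  else if d % 16 = 3 ∨ d % 16 = 13 then -Complex.I
  else 0

/-- `b_N (a b; c d) = exp (2 π i b d / N)`. -/
def bChar (N : ℕ) (γ : SL(2, ℤ)) : ℂ :=
  Complex.exp (2 * Real.pi * Complex.I * ((γ 0 1 : ℂ) * (γ 1 1 : ℂ) / N))

/-- `c_N (a b; c d) = exp (-2 π i c d / N)`. -/
def cChar (N : ℕ) (γ : SL(2, ℤ)) : ℂ :=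
  Complex.exp (-(2 * Real.pi * Complex.I * ((γ 1 0 : ℂ) * (γ 1 1 : ℂ) / N)))

/-! ### Automorphy factors on `Γ₀(2) ∩ Γ⁰(2)` -/

/-- `√(cτ + d)`, with the principal square root (argument in `(-π/2, π/2]`). -/
def sqrtDenom (γ : SL(2, ℤ)) (τ : ℍ) : ℂ := ((γ 1 0 : ℂ) * τ + (γ 1 1 : ℂ)) ^ (1 / 2 : ℂ)

/-- Weight `1/2*`: the factor `(c/d) √(cτ + d) ξ₈(d)`. -/
def J12 (γ : SL(2, ℤ)) (τ : ℍ) : ℂ :=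
  kroneckerOdd (γ 1 0) (γ 1 1) * sqrtDenom γ τ * xi8 (γ 1 1)

/-- Weight `3/4*`: the factor for which `√(η³)` is a form with character `c₁₆ b₁₆`. -/
def J34 (γ : SL(2, ℤ)) (τ : ℍ) : ℂ :=
  formSqrt (eta ^ 3) (γ • τ) / (cChar 16 γ * bChar 16 γ * formSqrt (eta ^ 3) τ)

/-- Weight `3/4* + a/2`, where `a = ⟨1/2⟩`: the factor for which `√(η^⟨1/2⟩³)` is a form with
character `conj χ₁₆ · c₈ b₃₂`. -/
def J34a (γ : SL(2, ℤ)) (τ : ℍ) : ℂ :=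
  formSqrt (rescale (1 / 2) eta ^ 3) (γ • τ) /
    ((starRingEnd ℂ) (chi16 (γ 1 1)) * cChar 8 γ * bChar 32 γ *
      formSqrt (rescale (1 / 2) eta ^ 3) τ)

/-- Weight `3/4* + A/2`, where `A = ⟨2⟩`: the factor for which `√(η^⟨2⟩³)` is a form with
character `χ₁₆ c₃₂ b₈`. -/
def J34A (γ : SL(2, ℤ)) (τ : ℍ) : ℂ :=
  formSqrt (rescale 2 eta ^ 3) (γ • τ) /
    (chi16 (γ 1 1) * cChar 32 γ * bChar 8 γ * formSqrt (rescale 2 eta ^ 3) τ)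

/-- Formal weight `a/2 = (3/4* + a/2) - 3/4*`. -/
def Ja (γ : SL(2, ℤ)) (τ : ℍ) : ℂ := J34a γ τ / J34 γ τ

/-- Formal weight `A/2 = (3/4* + A/2) - 3/4*`. -/
def JA (γ : SL(2, ℤ)) (τ : ℍ) : ℂ := J34A γ τ / J34 γ τ

/-- Weight `1/2* + (a + A)/2`. -/
def J12aA (γ : SL(2, ℤ)) (τ : ℍ) : ℂ := J12 γ τ * Ja γ τ * JA γ τ

/-! ### Spaces of forms -/

/-- `Γ₀(N) ∩ Γ⁰(N)`: the matrices `(a b; c d)` with `b ≡ c ≡ 0 mod N`. -/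
def Gam (N : ℕ) : Set SL(2, ℤ) := {γ | (N : ℤ) ∣ γ 1 0 ∧ (N : ℤ) ∣ γ 0 1}

/-- `f` is a modular form of weight `1/2* + (a + A)/2` and character `χ` on `Γ`, for
`Γ ⊆ Γ₀(2) ∩ Γ⁰(2)`: it is holomorphic, it transforms under `Γ` with the automorphy factor
above times `χ`, and it is holomorphic at all cusps. (The formal weights `a/2` and `A/2` only
contribute factors of absolute value `1`, so the growth condition is the one of weight `1/2`.) -/
def IsForm (Γ : Set SL(2, ℤ)) (χ : SL(2, ℤ) → ℂ) (f : ℍ → ℂ) : Prop :=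
  MDifferentiable 𝓘(ℂ) 𝓘(ℂ) f ∧
  (∀ γ ∈ Γ, ∀ τ : ℍ, f (γ • τ) = χ γ * J12aA γ τ * f τ) ∧
  (∀ α : SL(2, ℤ), IsBoundedAtImInfty fun τ : ℍ => f (α • τ) / sqrtDenom α τ)

/-- The character `c₈ b₈` of `Γ₀(2) ∩ Γ⁰(2)`. -/
def c8b8 (γ : SL(2, ℤ)) : ℂ := cChar 8 γ * bChar 8 γ

/-! ### The three square roots in the identity -/

/-- `[η, 7/4] [η, 1/4]`. -/
def prodQuarter : ℍ → ℂ := etaQuarter 7 * etaQuarter 1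

/-- `η^♮⟨1/2⟩ η^♮⟨2⟩`. -/
def prodNatural : ℍ → ℂ := rescale (1 / 2) (natural eta) * rescale 2 (natural eta)

/-- `η^♭⟨1/2⟩ η^♯⟨2⟩`. -/
def prodFlatSharp : ℍ → ℂ := rescale (1 / 2) (flat eta) * rescale 2 (sharp eta)

end EtaForms

end

open EtaForms

/-! By the Jacobi triple product, `etaNat`, `etaFlat` and `2 * etaSharp` are the theta constants θ₃,
θ₄, θ₂. Splitting the theta series by the parity of n gives θ₃(z) = θ₃(4z) + θ₂(4z) and θ₄(z) =
θ₃(4z) - θ₂(4z). With eta-quotient cancellation these yield the duplication formulas `etaFlat_sq`,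
`etaNat_sq`, `etaSharp_sq`. For odd c and ζ = exp(2πi/8) one gets [η, c/4] = θ₄ + ζ^c θ₂, so the
product for c = 7 and c = 1 is θ₄² + √2 θ₄θ₂ + θ₂². By the duplication formulas this is the square
of the right-hand side (`prodQuarter_apply`). The roots are explicit quotients in η and a
holomorphic √η, which exists because Euler's product has no zero in the disc. Leading terms and
uniqueness of normalized roots then turn the equality of squares into the identity.

For modularity, both roots on the right factor as R · η^♮ · (unit of weight zero). The quotient R of
cubes of √η is the one hidden in the definition of the weight, so it contributes J_κ / J_{1/2*} up
to explicit roots of unity (`J12aA_mul_unitR`), and no multiplier of √η is ever computed. The factor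
η^♮ is the classical theta function after a change of variable (`etaNat_transforms`). The
weight-zero units are integral eta quotients. Theta and half of the units are treated by induction
over generators of Γ₀(4) (`four_dvd_induction`), the other half by conjugation with S.

Growth at all cusps follows from |θ₂| + |θ₃| + |θ₄|: S and T permute the three terms up to the
common factor |cτ + d|^(1/2) (`thetaBound_smul`), and the sum dominates both roots. -/

noncomputable section

namespace EtaForms

/-! ### The Jacobi triple product -/

/-- The finite product `(1 - q) (1 - q²) ⋯ (1 - qᵐ)`. -/
def qFactorial (q : ℂ) (m : ℕ) : ℂ := ∏ j ∈ Finset.range m, (1 - q ^ (j + 1))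

/-- The Gaussian binomial coefficient at `q`. -/
def gaussBinom (q : ℂ) : ℕ → ℕ → ℂ
  | _, 0 => 1
  | 0, _ + 1 => 0
  | n + 1, k + 1 => gaussBinom q n k + q ^ (k + 1) * gaussBinom q n (k + 1)

/-- Euler's product `∏ (1 - qⁿ)`. -/
def eulerProd (q : ℂ) : ℂ := ∏' n : ℕ, (1 - q ^ (n + 1))

@[simp] lemma gaussBinom_zero_right (q : ℂ) (n : ℕ) : gaussBinom q n 0 = 1 := by
  cases n <;> rfl

lemma gaussBinom_succ_succ (q : ℂ) (n k : ℕ) : gaussBinom q (n + 1) (k + 1) =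
    gaussBinom q n k + q ^ (k + 1) * gaussBinom q n (k + 1) := rfl

lemma gaussBinom_eq_zero (q : ℂ) : ∀ {n k : ℕ}, n < k → gaussBinom q n k = 0
  | 0, k + 1, _ => rfl
  | n + 1, k + 1, h => by
    rw [gaussBinom_succ_succ, gaussBinom_eq_zero q (by omega : n < k),
      gaussBinom_eq_zero q (by omega : n < k + 1), mul_zero, add_zero]

lemma gaussBinom_self (q : ℂ) : ∀ n : ℕ, gaussBinom q n n = 1
  | 0 => rfl
  | n + 1 => by
    rw [gaussBinom_succ_succ, gaussBinom_self q n, gaussBinom_eq_zero q (Nat.lt_succ_self n),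
      mul_zero, add_zero]

lemma qFactorial_succ (q : ℂ) (m : ℕ) :
    qFactorial q (m + 1) = qFactorial q m * (1 - q ^ (m + 1)) := Finset.prod_range_succ _ _

lemma qFactorial_zero (q : ℂ) : qFactorial q 0 = 1 := Finset.prod_range_zero _

/-- Stated without division, so that it also holds where the factorials vanish. The induction rests
on (1 - q^(k+1)) + q^(k+1) (1 - q^(m+1)) = 1 - q^(m+k+2). -/
lemma gaussBinom_mul (q : ℂ) : ∀ m k : ℕ,
    gaussBinom q (m + k) k * (qFactorial q k * qFactorial q m) = qFactorial q (m + k)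
  | m, 0 => by simp [qFactorial_zero]
  | 0, k + 1 => by simp [gaussBinom_self, qFactorial_zero]
  | m + 1, k + 1 => by
    have h1 := gaussBinom_mul q (m + 1) k
    have h2 := gaussBinom_mul q m (k + 1)
    have e : m + 1 + k = m + (k + 1) := by omega
    rw [e] at h1
    rw [show m + 1 + (k + 1) = m + (k + 1) + 1 by omega, gaussBinom_succ_succ,
      qFactorial_succ q (m + (k + 1))]
    calc _ = gaussBinom q (m + (k + 1)) k * (qFactorial q k * qFactorial q (m + 1)) *
            (1 - q ^ (k + 1)) + q ^ (k + 1) * (1 - q ^ (m + 1)) *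
            (gaussBinom q (m + (k + 1)) (k + 1) * (qFactorial q (k + 1) * qFactorial q m)) := by
          rw [qFactorial_succ q k, qFactorial_succ q m]; ring
      _ = _ := by rw [h1, h2]; ring

/-- The finite `q`-binomial theorem. -/
lemma prod_one_add_mul_pow (q : ℂ) (M : ℕ) : ∀ x : ℂ,
    ∏ j ∈ Finset.range M, (1 + x * q ^ j) =
      ∑ k ∈ Finset.range (M + 1), q ^ (k.choose 2) * gaussBinom q M k * x ^ k := by
  induction M with
  | zero => intro x; simp
  | succ M ih =>
    intro x
    -- Once the factor at j = 0 is split off, the remaining product is the one of length M at xq.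
    have h := ih (x * q)
    rw [Finset.prod_range_succ']
    have e : ∏ j ∈ Finset.range M, (1 + x * q ^ (j + 1)) =
        ∏ j ∈ Finset.range M, (1 + x * q * q ^ j) :=
      Finset.prod_congr rfl fun j _ => by ring
    rw [e, h, Finset.sum_range_succ' _ (M + 1)]
    have hs : ∀ k, q ^ ((k + 1).choose 2) * gaussBinom q (M + 1) (k + 1) * x ^ (k + 1) =
        x * (q ^ (k.choose 2) * gaussBinom q M k * (x * q) ^ k) +
        q ^ ((k + 1).choose 2) * gaussBinom q M (k + 1) * (x * q) ^ (k + 1) := by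
      intro k
      rw [gaussBinom_succ_succ, Nat.choose_succ_succ' k 1, Nat.choose_one_right]
      ring
    rw [Finset.sum_congr rfl fun k _ => hs k, Finset.sum_add_distrib, ← Finset.mul_sum]
    rw [Finset.sum_range_succ (fun k => q ^ ((k + 1).choose 2) * gaussBinom q M (k + 1) *
      (x * q) ^ (k + 1)) M, gaussBinom_eq_zero q (Nat.lt_succ_self M)]
    rw [Finset.sum_range_succ' (fun k => q ^ (k.choose 2) * gaussBinom q M k * (x * q) ^ k) M]
    simp
    ring

/-- The finite Jacobi triple product. -/
lemma finite_triple_product {p z : ℂ} (hp : p ≠ 0) (hz : z ≠ 0) (N : ℕ) :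
    (∏ j ∈ Finset.range N, (1 + z * p ^ (2 * j + 1))) *
      (∏ j ∈ Finset.range N, (1 + z⁻¹ * p ^ (2 * j + 1))) =
    ∑ k ∈ Finset.range (2 * N + 1),
      gaussBinom (p ^ 2) (2 * N) k * (z ^ ((k : ℤ) - N) * p ^ (((k : ℤ) - N) ^ 2)) := by
  -- This x makes the 2N exponents of p symmetric: 1 - 2N, 3 - 2N, …, 2N - 1. The upper half is the
  -- product in z; pulling z p^(-(2j+1)) out of each factor of the lower half leaves the product in
  -- z⁻¹ and the prefactor z^N p^(-N²).
  have h := prod_one_add_mul_pow (p ^ 2) (2 * N) (z * p ^ (1 - 2 * N : ℤ))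
  rw [two_mul, Finset.prod_range_add] at h
  have e2 : ∀ j ∈ Finset.range N, 1 + z * p ^ (1 - 2 * N : ℤ) * (p ^ 2) ^ (N + j) =
      1 + z * p ^ (2 * j + 1) := by
    intro j _
    rw [mul_assoc, ← zpow_natCast (p ^ 2), ← zpow_natCast p 2, ← zpow_mul, ← zpow_add₀ hp,
      ← zpow_natCast p (2 * j + 1)]
    congr 3
    push_cast
    ring
  have e1 : ∀ N : ℕ, ∏ j ∈ Finset.range N, (1 + z * p ^ (1 - 2 * N : ℤ) * (p ^ 2) ^ j) =
      z ^ (N : ℤ) * p ^ (-(N : ℤ) ^ 2) *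
        ∏ j ∈ Finset.range N, (1 + z⁻¹ * p ^ (2 * j + 1)) := by
    intro N
    induction N with
    | zero => simp
    | succ N ih =>
      rw [Finset.prod_range_succ', Finset.prod_range_succ _ N]
      have : ∀ j ∈ Finset.range N, 1 + z * p ^ (1 - 2 * (N + 1 : ℕ) : ℤ) * (p ^ 2) ^ (j + 1) =
          1 + z * p ^ (1 - 2 * N : ℤ) * (p ^ 2) ^ j := by
        intro j _
        rw [pow_succ, mul_comm ((p ^ 2) ^ j), ← mul_assoc, mul_assoc z, ← zpow_natCast p 2,
          ← zpow_add₀ hp]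
        congr 4
        push_cast
        ring
      rw [Finset.prod_congr rfl this, ih]
      have h3 : (1 + z * p ^ (1 - 2 * (N + 1 : ℕ) : ℤ) * (p ^ 2) ^ 0) =
          z * p ^ (-(2 * N + 1) : ℤ) * (1 + z⁻¹ * p ^ (2 * N + 1)) := by
        rw [← zpow_natCast p (2 * N + 1)]
        push_cast
        rw [show (1 - 2 * ((N : ℤ) + 1)) = -(2 * N + 1) by ring, mul_add, mul_mul_mul_comm,
          mul_inv_cancel₀ hz, ← zpow_add₀ hp]
        simp
        ring
      rw [h3]
      have h4 : p ^ (-((N + 1 : ℕ) : ℤ) ^ 2) = p ^ (-(N : ℤ) ^ 2) * p ^ (-(2 * N + 1) : ℤ) := by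
        rw [← zpow_add₀ hp]
        congr 1
        push_cast
        ring
      rw [h4, Nat.cast_succ, zpow_add_one₀ hz]
      ring
  rw [e1 N, Finset.prod_congr rfl e2, ← two_mul] at h
  have hc : z ^ (N : ℤ) * p ^ (-(N : ℤ) ^ 2) ≠ 0 :=
    mul_ne_zero (zpow_ne_zero _ hz) (zpow_ne_zero _ hp)
  apply mul_left_cancel₀ hc
  rw [mul_comm (∏ j ∈ Finset.range N, (1 + z * p ^ (2 * j + 1))), ← mul_assoc, h, Finset.mul_sum]
  refine Finset.sum_congr rfl fun k _ => ?_
  rw [mul_comm ((p ^ 2) ^ _), mul_assoc, mul_left_comm _ (gaussBinom _ _ _)]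
  congr 1
  rw [mul_mul_mul_comm, ← zpow_add₀ hz, ← zpow_add₀ hp, mul_pow, ← zpow_natCast z, mul_left_comm]
  congr 1
  · congr 1; ring
  · rw [← zpow_natCast (p ^ 2), ← zpow_natCast p 2, ← zpow_mul, ← zpow_natCast (p ^ _), ← zpow_mul,
      ← zpow_add₀ hp]
    congr 1
    -- The exponents of p match because k(k-1) + k(1-2N) + N² = (k-N)².
    have : ((k.choose 2 : ℕ) : ℤ) * 2 = k * (k - 1) := by
      rcases k with _ | k
      · simp
      · rw [Nat.choose_two_right, Nat.add_sub_cancel]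
        have h2 : 2 ∣ (k + 1) * k := by
          rw [mul_comm]; exact (Nat.even_mul_succ_self k).two_dvd
        have := Nat.div_mul_cancel h2
        push_cast
        rw [add_sub_cancel_right]
        exact_mod_cast this
    push_cast
    linear_combination this

lemma eulerProd_ne_zero {q : ℂ} (hq : ‖q‖ < 1) : eulerProd q ≠ 0 := by
  unfold eulerProd
  simp_rw [sub_eq_add_neg]
  refine tprod_one_add_ne_zero_of_summable (f := fun n : ℕ ↦ -q ^ (n + 1)) ?_ ?_
  · intro n h
    have h1 : q ^ (n + 1) = 1 := by linear_combination -h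
    have h2 : ‖q‖ ^ (n + 1) < 1 := pow_lt_one₀ (norm_nonneg _) hq (by omega)
    rw [← norm_pow, h1, norm_one] at h2
    exact lt_irrefl _ h2
  · simpa using (summable_nat_add_iff 1).mpr (summable_geometric_of_lt_one (norm_nonneg _) hq)

lemma tendsto_qFactorial {q : ℂ} (hq : ‖q‖ < 1) :
    Tendsto (qFactorial q) atTop (𝓝 (eulerProd q)) :=
  (ModularForm.multipliable_one_sub_pow hq).hasProd.tendsto_prod_nat

lemma qFactorial_ne_zero {q : ℂ} (hq : ‖q‖ < 1) (m : ℕ) : qFactorial q m ≠ 0 := by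
  refine Finset.prod_ne_zero_iff.2 fun n _ h => ?_
  have h1 : q ^ (n + 1) = 1 := by linear_combination -h
  have h2 : ‖q‖ ^ (n + 1) < 1 := pow_lt_one₀ (norm_nonneg _) hq (by omega)
  rw [← norm_pow, h1, norm_one] at h2
  exact lt_irrefl _ h2

lemma gaussBinom_eq {q : ℂ} (hq : ‖q‖ < 1) {n k : ℕ} (h : k ≤ n) :
    gaussBinom q n k = qFactorial q n * (qFactorial q k)⁻¹ * (qFactorial q (n - k))⁻¹ := by
  have := gaussBinom_mul q (n - k) k
  rw [Nat.sub_add_cancel h] at this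
  have h1 := qFactorial_ne_zero hq k
  have h2 := qFactorial_ne_zero hq (n - k)
  field_simp
  rw [← this]; ring

/-- The q-factorials converge to a nonzero limit, so they and their inverses are bounded. This
supplies the majorant for the limit N → ∞ in the triple product. -/
lemma exists_norm_gaussBinom_le {q : ℂ} (hq : ‖q‖ < 1) :
    ∃ C : ℝ, 0 ≤ C ∧ ∀ n k, ‖gaussBinom q n k‖ ≤ C := by
  have h1 := tendsto_qFactorial hq
  obtain ⟨A, hA⟩ := (Metric.isBounded_range_of_tendsto _ h1).exists_norm_le
  obtain ⟨B, hB⟩ := (Metric.isBounded_range_of_tendsto _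
    (h1.inv₀ (eulerProd_ne_zero hq))).exists_norm_le
  have hA' := fun n => hA _ (Set.mem_range_self n)
  have hB' := fun n => hB _ (Set.mem_range_self n)
  have hA0 : 0 ≤ A := (norm_nonneg _).trans (hA' 0)
  have hB0 : 0 ≤ B := (norm_nonneg _).trans (hB' 0)
  refine ⟨A * B * B, by positivity, fun n k => ?_⟩
  rcases le_or_gt k n with h | h
  · rw [gaussBinom_eq hq h, norm_mul, norm_mul]
    gcongr
    · exact hA' n
    · exact hB' k
    · exact hB' (n - k)
  · rw [gaussBinom_eq_zero q h, norm_zero]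
    positivity

/-- The Jacobi triple product identity. -/
theorem jacobiTheta₂_eq_prod (w : ℂ) {τ : ℂ} (hτ : 0 < τ.im) :
    jacobiTheta₂ w τ = eulerProd (Complex.exp (Real.pi * Complex.I * τ) ^ 2) *
      ((∏' n : ℕ, (1 + Complex.exp (2 * Real.pi * Complex.I * w) *
        Complex.exp (Real.pi * Complex.I * τ) ^ (2 * n + 1))) *
      (∏' n : ℕ, (1 + (Complex.exp (2 * Real.pi * Complex.I * w))⁻¹ *
        Complex.exp (Real.pi * Complex.I * τ) ^ (2 * n + 1)))) := by
  set p := Complex.exp (Real.pi * Complex.I * τ) with hp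
  set z := Complex.exp (2 * Real.pi * Complex.I * w) with hz
  have p0 : p ≠ 0 := Complex.exp_ne_zero _
  have z0 : z ≠ 0 := Complex.exp_ne_zero _
  have p1 : ‖p‖ < 1 := by
    rw [hp, Complex.norm_exp, Real.exp_lt_one_iff]
    simp
    positivity
  have q1 : ‖p ^ 2‖ < 1 := by
    rw [norm_pow]
    exact pow_lt_one₀ (norm_nonneg _) p1 two_ne_zero
  have term : ∀ n : ℤ, jacobiTheta₂_term n w τ = z ^ n * p ^ (n ^ 2) := by
    intro n
    rw [jacobiTheta₂_term, hz, hp, ← Complex.exp_int_mul, ← Complex.exp_int_mul, ← Complex.exp_add]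
    congr 1
    push_cast
    ring
  have mult : ∀ c : ℂ, Multipliable fun n : ℕ => 1 + c * p ^ (2 * n + 1) := by
    intro c
    apply multipliable_one_add_of_summable
    have : ∀ n : ℕ, ‖c * p ^ (2 * n + 1)‖ = ‖c‖ * (‖p ^ 2‖ ^ n * ‖p‖) := fun n => by
      rw [pow_add, pow_mul, pow_one, norm_mul, norm_mul, norm_pow (p ^ 2)]
    simp only [this]
    exact ((summable_geometric_of_lt_one (norm_nonneg _) q1).mul_right _).mul_left _
  have lim1 := ((mult z).hasProd.tendsto_prod_nat).mul ((mult z⁻¹).hasProd.tendsto_prod_nat)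
  simp only [finite_triple_product p0 z0] at lim1
  obtain ⟨C, C0, hC⟩ := exists_norm_gaussBinom_le q1
  -- The finite sum is reindexed by n = k - N and extended by zero to ℤ. For fixed n the Gaussian
  -- coefficient tends to E · E⁻¹ · E⁻¹ = E⁻¹ with E = `eulerProd (p ^ 2)`, and C times the norm of
  -- the theta term dominates.
  let f : ℕ → ℤ → ℂ := fun N n => if -(N : ℤ) ≤ n ∧ n ≤ N then
    gaussBinom (p ^ 2) (2 * N) (N + n).toNat * jacobiTheta₂_term n w τ else 0
  have hf : ∀ N : ℕ, ∑ k ∈ Finset.range (2 * N + 1),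
      gaussBinom (p ^ 2) (2 * N) k * (z ^ ((k : ℤ) - N) * p ^ (((k : ℤ) - N) ^ 2)) =
      ∑' n, f N n := by
    intro N
    let e : ℕ ↪ ℤ := ⟨fun k => (k : ℤ) - N, fun a b h => by
      have h' : (a : ℤ) - N = b - N := h
      omega⟩
    rw [tsum_eq_sum (s := (Finset.range (2 * N + 1)).map e), Finset.sum_map]
    · refine Finset.sum_congr rfl fun k hk => ?_
      rw [Finset.mem_range] at hk
      have h1 : -(N : ℤ) ≤ (k : ℤ) - N ∧ (k : ℤ) - N ≤ N := by omega
      change _ = if -(N : ℤ) ≤ (k : ℤ) - N ∧ (k : ℤ) - N ≤ N then _ else _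
      rw [if_pos h1, term]
      congr 2
      change _ = ((N : ℤ) + ((k : ℤ) - N)).toNat
      omega
    · intro n hn
      refine if_neg fun h => hn ?_
      rw [Finset.mem_map]
      refine ⟨(N + n).toNat, Finset.mem_range.2 (by omega), ?_⟩
      change (((N + n).toNat : ℕ) : ℤ) - N = n
      omega
  have lim2 : Tendsto (fun N => ∑' n, f N n) atTop
      (𝓝 (∑' n, (eulerProd (p ^ 2))⁻¹ * jacobiTheta₂_term n w τ)) := by
    have hs := ((summable_jacobiTheta₂_term_iff w τ).2 hτ).norm
    refine tendsto_tsum_of_dominated_convergence (hs.mul_left C) (fun n => ?_)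
      (Eventually.of_forall fun N n => ?_)
    · have a1 : Tendsto (fun N : ℕ => (2 * N : ℕ)) atTop atTop :=
        tendsto_id.const_mul_atTop' two_pos
      have a2 : Tendsto (fun N : ℕ => ((N : ℤ) + n).toNat) atTop atTop :=
        tendsto_atTop.2 fun b => (eventually_ge_atTop (b + n.natAbs)).mono fun N hN => by omega
      have a3 : Tendsto (fun N : ℕ => 2 * N - ((N : ℤ) + n).toNat) atTop atTop :=
        tendsto_atTop.2 fun b => (eventually_ge_atTop (b + n.natAbs)).mono fun N hN => by omega
      have t := tendsto_qFactorial q1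
      have e0 := eulerProd_ne_zero q1
      have l := (((t.comp a1).mul ((t.comp a2).inv₀ e0)).mul ((t.comp a3).inv₀ e0)).mul_const
        (jacobiTheta₂_term n w τ)
      rw [mul_inv_cancel₀ e0, one_mul] at l
      refine l.congr' ((eventually_ge_atTop n.natAbs).mono fun N hN => ?_)
      have h1 : -(N : ℤ) ≤ n ∧ n ≤ N := by omega
      simp only [f, if_pos h1, Function.comp_apply]
      rw [gaussBinom_eq q1 (by omega)]
    · simp only [f]
      split_ifs
      · rw [norm_mul]
        exact mul_le_mul_of_nonneg_right (hC _ _) (norm_nonneg _)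
      · rw [norm_zero]
        positivity
  simp only [hf] at lim1
  have key := tendsto_nhds_unique lim1 lim2
  rw [key, tsum_mul_left, ← mul_assoc, mul_inv_cancel₀ (eulerProd_ne_zero q1), one_mul]
  rfl

/-! ### Theta functions as eta quotients -/

/-- `η^♮` as a function of a complex variable. -/
def etaNat (z : ℂ) : ℂ :=
  ModularForm.eta z ^ 5 / (ModularForm.eta (z / 2) ^ 2 * ModularForm.eta (2 * z) ^ 2)

/-- `η^♭` as a function of a complex variable. -/
def etaFlat (z : ℂ) : ℂ := ModularForm.eta (z / 2) ^ 2 / ModularForm.eta z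

/-- `η^♯` as a function of a complex variable. -/
def etaSharp (z : ℂ) : ℂ := ModularForm.eta (2 * z) ^ 2 / ModularForm.eta z

lemma eta_eq_exp_mul_eulerProd (z : ℂ) : ModularForm.eta z =
    Complex.exp (2 * Real.pi * Complex.I * z / 24) *
      eulerProd (Complex.exp (2 * Real.pi * Complex.I * z)) := by
  simp [ModularForm.eta, eulerProd, Function.Periodic.qParam, ModularForm.eta_q]

lemma eta_ne_zero' {z : ℂ} (hz : 0 < z.im) : ModularForm.eta z ≠ 0 := ModularForm.eta_ne_zero hz

lemma eta_add_intCast (z : ℂ) (n : ℤ) : ModularForm.eta (z + n) =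
    Complex.exp (2 * Real.pi * Complex.I * n / 24) * ModularForm.eta z := by
  rw [eta_eq_exp_mul_eulerProd, eta_eq_exp_mul_eulerProd, ← mul_assoc, ← Complex.exp_add]
  congr 2
  · ring
  · rw [mul_add, Complex.exp_add, mul_comm (2 * Real.pi * Complex.I) (n : ℂ),
      Complex.exp_int_mul_two_pi_mul_I, mul_one]

lemma multipliable_one_add_mul_pow (c : ℂ) {q : ℂ} (hq : ‖q‖ < 1) :
    Multipliable fun n : ℕ => 1 + c * q ^ n := by
  apply multipliable_one_add_of_summable
  simp only [norm_mul, norm_pow]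
  exact (summable_geometric_of_lt_one (norm_nonneg _) hq).mul_left _

lemma norm_sq_lt_one {q : ℂ} (hq : ‖q‖ < 1) : ‖q ^ 2‖ < 1 := by
  rw [norm_pow]
  exact pow_lt_one₀ (norm_nonneg _) hq two_ne_zero

lemma multipliable_one_add_mul_pow_odd (c : ℂ) {q : ℂ} (hq : ‖q‖ < 1) :
    Multipliable fun n : ℕ => 1 + c * q ^ (2 * n + 1) :=
  (multipliable_one_add_mul_pow (c * q) (norm_sq_lt_one hq)).congr fun n => by
    rw [pow_succ q (2 * n), pow_mul]; ring

lemma eulerProd_mul_tprod_one_add {q : ℂ} (hq : ‖q‖ < 1) :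
    eulerProd q * ∏' n : ℕ, (1 + q ^ (n + 1)) = eulerProd (q ^ 2) := by
  have h : Multipliable fun n : ℕ => 1 + q ^ (n + 1) :=
    (multipliable_one_add_mul_pow q hq).congr fun n => by ring
  rw [eulerProd, ← (ModularForm.multipliable_one_sub_pow hq).tprod_mul h, eulerProd]
  exact tprod_congr fun n => by ring

lemma tprod_odd_mul_eulerProd {q : ℂ} (hq : ‖q‖ < 1) :
    (∏' n : ℕ, (1 - q ^ (2 * n + 1))) * eulerProd (q ^ 2) = eulerProd q := by
  have h1 : Multipliable fun n : ℕ => 1 - q ^ (2 * n + 1) :=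
    (multipliable_one_add_mul_pow_odd (-1) hq).congr fun n => by ring
  have h2 : Multipliable fun n : ℕ => 1 - q ^ (2 * n + 1 + 1) :=
    (ModularForm.multipliable_one_sub_pow (norm_sq_lt_one hq)).congr fun n => by ring
  rw [eulerProd, eulerProd, ← tprod_even_mul_odd (f := fun n : ℕ => 1 - q ^ (n + 1)) h1 h2]
  congr 1
  exact tprod_congr fun n => by ring

/-- The product of all 1 + q^n is `eulerProd (q ^ 2) / eulerProd q`, and its even part is the same
expression at q²; the odd part is the quotient of the two. -/
lemma tprod_one_add_odd_mul {q : ℂ} (hq : ‖q‖ < 1) :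
    (∏' n : ℕ, (1 + q ^ (2 * n + 1))) * (eulerProd q * eulerProd (q ^ 4)) =
      eulerProd (q ^ 2) ^ 2 := by
  have h1 : Multipliable fun n : ℕ => 1 + q ^ (2 * n + 1) :=
    (multipliable_one_add_mul_pow_odd 1 hq).congr fun n => by ring
  have h2 : Multipliable fun n : ℕ => 1 + q ^ (2 * n + 1 + 1) :=
    (multipliable_one_add_mul_pow (q ^ 2) (norm_sq_lt_one hq)).congr fun n => by ring
  have h := tprod_even_mul_odd (f := fun n : ℕ => 1 + q ^ (n + 1)) h1 h2
  have e1 := eulerProd_mul_tprod_one_add hq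
  have e2 := eulerProd_mul_tprod_one_add (norm_sq_lt_one hq)
  rw [← pow_mul] at e2
  have e3 : ∏' n : ℕ, (1 + q ^ (2 * n + 1 + 1)) = ∏' n : ℕ, (1 + (q ^ 2) ^ (n + 1)) :=
    tprod_congr fun n => by ring
  rw [e3] at h
  rw [show 2 * 2 = 4 from rfl] at e2
  rw [← e2, sq (eulerProd (q ^ 2))]
  nth_rewrite 3 [← e1]
  rw [← h]
  ring

section

variable {z : ℂ}

lemma norm_exp_pi_I_mul_lt_one (hz : 0 < z.im) : ‖Complex.exp (Real.pi * Complex.I * z)‖ < 1 := by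
  rw [Complex.norm_exp, Real.exp_lt_one_iff]
  simp
  positivity

lemma eta_half_eq (z : ℂ) : ModularForm.eta (z / 2) =
    Complex.exp (2 * Real.pi * Complex.I * z / 48) *
      eulerProd (Complex.exp (Real.pi * Complex.I * z)) := by
  rw [eta_eq_exp_mul_eulerProd]
  congr 2 <;> ring_nf

lemma eta_eq_eulerProd_sq (z : ℂ) : ModularForm.eta z =
    Complex.exp (2 * Real.pi * Complex.I * z / 48) ^ 2 *
      eulerProd (Complex.exp (Real.pi * Complex.I * z) ^ 2) := by
  rw [eta_eq_exp_mul_eulerProd, ← Complex.exp_nat_mul, ← Complex.exp_nat_mul]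
  congr 2 <;> · push_cast; ring_nf

lemma eta_two_mul_eq (z : ℂ) : ModularForm.eta (2 * z) =
    Complex.exp (2 * Real.pi * Complex.I * z / 48) ^ 4 *
      eulerProd (Complex.exp (Real.pi * Complex.I * z) ^ 4) := by
  rw [eta_eq_exp_mul_eulerProd, ← Complex.exp_nat_mul, ← Complex.exp_nat_mul]
  congr 2 <;> · push_cast; ring_nf

lemma eulerProd_ne_zero_of_im_pos (hz : 0 < z.im) (n : ℕ) (hn : n ≠ 0) :
    eulerProd (Complex.exp (Real.pi * Complex.I * z) ^ n) ≠ 0 :=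
  eulerProd_ne_zero (by
    rw [norm_pow]; exact pow_lt_one₀ (norm_nonneg _) (norm_exp_pi_I_mul_lt_one hz) hn)

/-- This and the next two lemmas are the triple product at w = 0, 1/2 and z/2, that is, the product
formulas for θ₃, θ₄ and θ₂. -/
lemma etaNat_eq_jacobiTheta₂ (hz : 0 < z.im) : etaNat z = jacobiTheta₂ 0 z := by
  rw [jacobiTheta₂_eq_prod 0 hz, etaNat, eta_half_eq, eta_eq_eulerProd_sq, eta_two_mul_eq]
  have hp := norm_exp_pi_I_mul_lt_one hz
  have h1 := eulerProd_ne_zero hp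
  have h2 := eulerProd_ne_zero_of_im_pos hz 2 (by norm_num)
  have h4 := eulerProd_ne_zero_of_im_pos hz 4 (by norm_num)
  have h := tprod_one_add_odd_mul hp
  have he := Complex.exp_ne_zero (2 * Real.pi * Complex.I * z / 48)
  simp only [mul_zero, Complex.exp_zero, inv_one, one_mul]
  rw [← eq_div_iff (mul_ne_zero h1 h4)] at h
  rw [h]
  field_simp

lemma etaFlat_eq_jacobiTheta₂ (hz : 0 < z.im) : etaFlat z = jacobiTheta₂ (1 / 2) z := by
  rw [jacobiTheta₂_eq_prod (1 / 2) hz, etaFlat, eta_half_eq, eta_eq_eulerProd_sq]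
  have hp := norm_exp_pi_I_mul_lt_one hz
  have h2 := eulerProd_ne_zero_of_im_pos hz 2 (by norm_num)
  have h := tprod_odd_mul_eulerProd hp
  have he := Complex.exp_ne_zero (2 * Real.pi * Complex.I * z / 48)
  have e : Complex.exp (2 * Real.pi * Complex.I * (1 / 2)) = -1 := by
    rw [← Complex.exp_pi_mul_I]; congr 1; ring
  rw [e, inv_neg, inv_one]
  simp only [neg_mul, one_mul, ← sub_eq_add_neg]
  rw [← eq_div_iff h2] at h
  rw [h]
  field_simp

lemma two_mul_etaSharp_eq_jacobiTheta₂ (hz : 0 < z.im) : 2 * etaSharp z =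
    Complex.exp (Real.pi * Complex.I * z / 4) * jacobiTheta₂ (z / 2) z := by
  rw [jacobiTheta₂_eq_prod (z / 2) hz, etaSharp, eta_two_mul_eq, eta_eq_eulerProd_sq]
  have hp := norm_exp_pi_I_mul_lt_one hz
  have h2 := eulerProd_ne_zero_of_im_pos hz 2 (by norm_num)
  have h := eulerProd_mul_tprod_one_add (norm_sq_lt_one hp)
  have he := Complex.exp_ne_zero (2 * Real.pi * Complex.I * z / 48)
  have hpe := Complex.exp_ne_zero (Real.pi * Complex.I * z)
  have e : Complex.exp (2 * Real.pi * Complex.I * (z / 2)) = Complex.exp (Real.pi * Complex.I * z) := by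
    congr 1; ring
  have e' : Complex.exp (Real.pi * Complex.I * z / 4) =
      Complex.exp (2 * Real.pi * Complex.I * z / 48) ^ 6 := by
    rw [← Complex.exp_nat_mul]; congr 1; push_cast; ring
  rw [e, e']
  set p := Complex.exp (Real.pi * Complex.I * z)
  have a1 : ∏' n : ℕ, (1 + p * p ^ (2 * n + 1)) = ∏' n : ℕ, (1 + (p ^ 2) ^ (n + 1)) :=
    tprod_congr fun n => by ring
  -- The factor at n = 0 is 1 + p⁻¹p = 2; this is the 2 in front of `etaSharp`.
  have a2 : ∏' n : ℕ, (1 + p⁻¹ * p ^ (2 * n + 1)) = 2 * ∏' n : ℕ, (1 + (p ^ 2) ^ (n + 1)) := by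
    have b : ∀ n : ℕ, 1 + p⁻¹ * p ^ (2 * n + 1) = 1 + (p ^ 2) ^ n := fun n => by
      rw [pow_succ, pow_mul]; field_simp
    rw [tprod_congr b, tprod_eq_zero_mul']
    · norm_num
    · exact (multipliable_one_add_mul_pow (p ^ 2) (norm_sq_lt_one hp)).congr fun n => by ring
  rw [a1, a2]
  rw [← pow_mul, mul_comm, ← eq_div_iff h2] at h
  rw [h]
  field_simp

lemma hasSum_int_even_add_odd {f : ℤ → ℂ} {a b : ℂ} (he : HasSum (fun n => f (2 * n)) a)
    (ho : HasSum (fun n => f (2 * n + 1)) b) : HasSum f (a + b) := by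
  have i1 : Function.Injective fun n : ℤ => 2 * n := fun m n h => by
    have h' : 2 * m = 2 * n := h
    omega
  have i2 : Function.Injective fun n : ℤ => 2 * n + 1 := fun m n h => by
    have h' : 2 * m + 1 = 2 * n + 1 := h
    omega
  refine (i1.hasSum_range_iff.2 he).add_isCompl ?_ (i2.hasSum_range_iff.2 ho)
  rw [isCompl_iff, Set.disjoint_iff_forall_ne, codisjoint_iff_le_sup]
  refine ⟨?_, fun n _ => ?_⟩
  · rintro _ ⟨m, rfl⟩ _ ⟨n, rfl⟩ h
    have h' : 2 * m = 2 * n + 1 := h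
    omega
  · rcases Int.even_or_odd' n with ⟨m, h | h⟩
    · exact Or.inl ⟨m, h.symm⟩
    · exact Or.inr ⟨m, h.symm⟩

/-- Splitting the theta series into even and odd terms. -/
lemma jacobiTheta₂_eq_even_add_odd (w : ℂ) (hz : 0 < z.im) : jacobiTheta₂ w z =
    jacobiTheta₂ (2 * w) (4 * z) + Complex.exp (2 * Real.pi * Complex.I * w) *
      (Complex.exp (Real.pi * Complex.I * z) * jacobiTheta₂ (2 * w + 2 * z) (4 * z)) := by
  have hz4 : 0 < (4 * z).im := by simp; positivity
  have h1 := hasSum_jacobiTheta₂_term (2 * w) hz4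
  have h2 := ((hasSum_jacobiTheta₂_term (2 * w + 2 * z) hz4).mul_left
    (Complex.exp (Real.pi * Complex.I * z))).mul_left (Complex.exp (2 * Real.pi * Complex.I * w))
  refine (hasSum_jacobiTheta₂_term w hz).unique (hasSum_int_even_add_odd ?_ ?_)
  · refine (congrArg (HasSum · _) (funext fun n => ?_)).mpr h1
    simp only [jacobiTheta₂_term]
    congr 1; push_cast; ring
  · refine (congrArg (HasSum · _) (funext fun n => ?_)).mpr h2
    simp only [jacobiTheta₂_term, ← Complex.exp_add]
    congr 1; push_cast; ring

/-- Even n contribute θ₃(4z) and odd n contribute θ₂(4z). In `etaFlat_eq` the odd terms change sign.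
-/
lemma etaNat_eq (hz : 0 < z.im) : etaNat z = etaNat (4 * z) + 2 * etaSharp (4 * z) := by
  have hz4 : 0 < (4 * z).im := by simp; positivity
  rw [two_mul_etaSharp_eq_jacobiTheta₂ hz4, etaNat_eq_jacobiTheta₂ hz, etaNat_eq_jacobiTheta₂ hz4,
    jacobiTheta₂_eq_even_add_odd 0 hz]
  simp only [mul_zero, Complex.exp_zero, zero_add, one_mul]
  congr 3 <;> ring_nf

lemma etaFlat_eq (hz : 0 < z.im) : etaFlat z = etaNat (4 * z) - 2 * etaSharp (4 * z) := by
  have hz4 : 0 < (4 * z).im := by simp; positivity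
  rw [two_mul_etaSharp_eq_jacobiTheta₂ hz4, etaFlat_eq_jacobiTheta₂ hz, etaNat_eq_jacobiTheta₂ hz4,
    jacobiTheta₂_eq_even_add_odd (1 / 2) hz]
  have e : Complex.exp (2 * Real.pi * Complex.I * (1 / 2)) = -1 := by
    rw [← Complex.exp_pi_mul_I]; congr 1; ring
  have a := jacobiTheta₂_add_left 0 (4 * z)
  have b := jacobiTheta₂_add_left (2 * z) (4 * z)
  rw [zero_add] at a
  rw [e, show (2 : ℂ) * (1 / 2) = 1 by norm_num, a, add_comm 1 (2 * z), b]
  rw [show 4 * z / 2 = 2 * z by ring, show Real.pi * Complex.I * (4 * z) / 4 =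
    Real.pi * Complex.I * z by ring]
  ring

/-- Since n² and n have the same parity, an odd translation multiplies the n-th term by (-1)^n,
which is the shift w = 1/2. -/
lemma etaNat_add_odd (hz : 0 < z.im) (k : ℤ) : etaNat (z + (2 * k + 1 : ℤ)) = etaFlat z := by
  have hz' : 0 < (z + (2 * k + 1 : ℤ)).im := by rwa [Complex.add_im, Complex.intCast_im, add_zero]
  rw [etaNat_eq_jacobiTheta₂ hz', etaFlat_eq_jacobiTheta₂ hz]
  refine tsum_congr fun n => ?_
  simp only [jacobiTheta₂_term]
  rw [Complex.exp_eq_exp_iff_exists_int]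
  obtain ⟨m, hm⟩ := Int.even_mul_succ_self (n - 1)
  refine ⟨n ^ 2 * k + m, ?_⟩
  have hm' : ((n : ℂ) - 1) * n = m + m := by
    have := congrArg (Int.cast : ℤ → ℂ) hm
    push_cast at this
    rw [sub_add_cancel] at this
    exact this
  push_cast
  linear_combination (Real.pi * Complex.I) * hm'

lemma etaFlat_add_odd (hz : 0 < z.im) (k : ℤ) : etaFlat (z + (2 * k + 1 : ℤ)) = etaNat z := by
  have hz' : 0 < (z + (2 * k + 1 : ℤ)).im := by rwa [Complex.add_im, Complex.intCast_im, add_zero]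
  rw [← etaNat_add_odd hz' (-k - 1)]
  congr 1
  push_cast
  ring

lemma etaSharp_add_intCast (z : ℂ) (n : ℤ) : etaSharp (z + n) =
    Complex.exp (2 * Real.pi * Complex.I * n / 8) * etaSharp z := by
  have h : 2 * (z + n) = 2 * z + (2 * n : ℤ) := by push_cast; ring
  rw [etaSharp, etaSharp, h, eta_add_intCast, eta_add_intCast, mul_pow, mul_div_mul_comm,
    ← Complex.exp_nat_mul, ← Complex.exp_sub]
  congr 2
  push_cast
  ring

lemma etaNat_mul_etaFlat (hz : 0 < z.im) : etaNat z * etaFlat z = etaFlat (2 * z) ^ 2 := by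
  have h1 : ModularForm.eta z ≠ 0 := eta_ne_zero' hz
  have h2 : ModularForm.eta (z / 2) ≠ 0 := eta_ne_zero' (by simpa using hz)
  have h3 : ModularForm.eta (2 * z) ≠ 0 := eta_ne_zero' (by simpa using hz)
  rw [etaNat, etaFlat, etaFlat, mul_div_cancel_left₀ z two_ne_zero]
  field_simp

lemma etaNat_mul_etaSharp (hz : 0 < z.im) : etaNat z * etaSharp z * 2 = 2 * etaSharp (z / 2) ^ 2 := by
  have h1 : ModularForm.eta z ≠ 0 := eta_ne_zero' hz
  have h2 : ModularForm.eta (z / 2) ≠ 0 := eta_ne_zero' (by simpa using hz)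
  have h3 : ModularForm.eta (2 * z) ≠ 0 := eta_ne_zero' (by simpa using hz)
  rw [etaNat, etaSharp, etaSharp, mul_div_cancel₀ z two_ne_zero]
  rw [mul_comm 2 z] at h3 ⊢
  field_simp

lemma etaSharp_sq (hz : 0 < z.im) : etaSharp z ^ 2 = etaNat (2 * z) * etaSharp (2 * z) := by
  have h := etaNat_mul_etaSharp (z := 2 * z) (by simpa using hz)
  rw [mul_div_cancel_left₀ z two_ne_zero] at h
  linear_combination -h / 2

/-- Cancelling eta quotients gives θ₄(z)² = θ₃(z/2) θ₄(z/2); the two dissections at z/2 make this a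
difference of squares. -/
lemma etaFlat_sq (hz : 0 < z.im) :
    etaFlat z ^ 2 = etaNat (2 * z) ^ 2 - (2 * etaSharp (2 * z)) ^ 2 := by
  have hz2 : 0 < (z / 2).im := by simpa using hz
  have h := etaNat_mul_etaFlat hz2
  rw [mul_div_cancel₀ z two_ne_zero, etaNat_eq hz2, etaFlat_eq hz2,
    show 4 * (z / 2) = 2 * z by ring] at h
  rw [← h]; ring

/-- This is `etaFlat_sq` translated by 1: the left side becomes θ₃, θ₃(2z) is unchanged, and θ₂(2z)
is multiplied by exp(2πi/4) = i, which reverses the sign of its square. -/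
lemma etaNat_sq (hz : 0 < z.im) :
    etaNat z ^ 2 = etaNat (2 * z) ^ 2 + (2 * etaSharp (2 * z)) ^ 2 := by
  have hz1 : 0 < (z + 1).im := by simpa using hz
  have hz2 : 0 < (2 * z).im := by simpa using hz
  have h := etaFlat_sq hz1
  have e := etaFlat_add_odd hz 0
  have e1 := etaSharp_add_intCast (2 * z) 2
  have hz3 : 0 < (2 * z + 1).im := by simpa using hz2
  have e2 := etaNat_add_odd hz3 0
  have e4 := etaFlat_add_odd hz2 0
  norm_num at e e1 e2 e4
  have e3 : Complex.exp (2 * Real.pi * Complex.I * 2 / 8) ^ 2 = -1 := by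
    rw [← Complex.exp_nat_mul, ← Complex.exp_pi_mul_I]; congr 1; push_cast; ring
  rw [e, mul_add, mul_one, e1] at h
  rw [e4, add_assoc] at e2
  norm_num at e2
  rw [e2] at h
  rw [h]
  linear_combination (-4 * etaSharp (2 * z) ^ 2) * e3

end

/-! ### The normalized square root of eta -/

lemma eulerProd_zero : eulerProd 0 = 1 := by simp [eulerProd]

/-- The logarithmic derivative has a primitive F on the disc with F(0) = 0. The function exp(-F)
times the product has derivative zero, so exp(F/2) is the required root. -/
lemma exists_sqrt_eulerProd : ∃ S : ℂ → ℂ, DifferentiableOn ℂ S (Metric.ball 0 1) ∧ S 0 = 1 ∧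
    ∀ q ∈ Metric.ball (0 : ℂ) 1, S q ^ 2 = eulerProd q := by
  have hd : DifferentiableOn ℂ eulerProd (Metric.ball 0 1) :=
    ModularForm.differentiableOn_tprod_one_sub_pow
  have h0 : ∀ q ∈ Metric.ball (0 : ℂ) 1, eulerProd q ≠ 0 := fun q hq =>
    eulerProd_ne_zero (by simpa using hq)
  have hl : DifferentiableOn ℂ (fun q => deriv eulerProd q / eulerProd q) (Metric.ball 0 1) :=
    (hd.deriv Metric.isOpen_ball).div hd h0
  obtain ⟨F, hF0, hF⟩ := hl.isExactOn_ball.with_val_at 0 0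
  have hc : ∀ q ∈ Metric.ball (0 : ℂ) 1, Complex.exp (F q) = eulerProd q := by
    have hdd : ∀ q ∈ Metric.ball (0 : ℂ) 1,
        HasDerivAt (fun q => Complex.exp (-F q) * eulerProd q) 0 q := by
      intro q hq
      have h1 := ((hF q hq).neg.cexp).mul
        (hd.differentiableAt (Metric.isOpen_ball.mem_nhds hq)).hasDerivAt
      refine h1.congr_deriv ?_
      have := h0 q hq
      field_simp
      ring
    have hconst : ∀ q ∈ Metric.ball (0 : ℂ) 1, Complex.exp (-F q) * eulerProd q = 1 := by
      intro q hq
      have := (Metric.isOpen_ball (x := (0 : ℂ)) (ε := 1)).is_const_of_deriv_eq_zero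
        (convex_ball 0 1).isPreconnected
        (fun q hq => (hdd q hq).differentiableAt.differentiableWithinAt)
        (fun q hq => (hdd q hq).deriv) hq (Metric.mem_ball_self one_pos)
      rw [this, hF0, eulerProd_zero]
      simp
    intro q hq
    have := hconst q hq
    rw [Complex.exp_neg, inv_mul_eq_one₀ (Complex.exp_ne_zero _)] at this
    exact this
  refine ⟨fun q => Complex.exp (F q / 2), fun q hq => ?_, by simp [hF0], fun q hq => ?_⟩
  · exact ((hF q hq).div_const 2).cexp.differentiableAt.differentiableWithinAt
  · rw [← hc q hq, ← Complex.exp_nat_mul]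
    congr 1
    push_cast
    ring

/-- The holomorphic square root of Euler's product on the unit disc, with value `1` at `0`. -/
def sqrtEuler : ℂ → ℂ := exists_sqrt_eulerProd.choose

/-- The normalized square root of eta as a function of a complex variable. -/
def sqrtEta (z : ℂ) : ℂ := Complex.exp (2 * Real.pi * Complex.I * z / 48) *
  sqrtEuler (Complex.exp (2 * Real.pi * Complex.I * z))

section

variable {z : ℂ}

lemma exp_two_pi_I_mul_mem_ball (hz : 0 < z.im) :
    Complex.exp (2 * Real.pi * Complex.I * z) ∈ Metric.ball (0 : ℂ) 1 := by
  simpa using UpperHalfPlane.norm_exp_two_pi_I_lt_one ⟨z, hz⟩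

lemma sqrtEta_sq (hz : 0 < z.im) : sqrtEta z ^ 2 = ModularForm.eta z := by
  rw [sqrtEta, mul_pow, sqrtEuler,
    exists_sqrt_eulerProd.choose_spec.2.2 _ (exp_two_pi_I_mul_mem_ball hz),
    eta_eq_exp_mul_eulerProd, ← Complex.exp_nat_mul]
  congr 2
  push_cast
  ring

lemma sqrtEta_ne_zero (hz : 0 < z.im) : sqrtEta z ≠ 0 := fun h =>
  eta_ne_zero' hz (by rw [← sqrtEta_sq hz, h, zero_pow two_ne_zero])

lemma differentiableAt_sqrtEta (hz : 0 < z.im) : DifferentiableAt ℂ sqrtEta z := by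
  have h := exists_sqrt_eulerProd.choose_spec.1.differentiableAt
    (Metric.isOpen_ball.mem_nhds (exp_two_pi_I_mul_mem_ball hz))
  have h2 : DifferentiableAt ℂ (fun z => Complex.exp (2 * Real.pi * Complex.I * z)) z := by fun_prop
  exact DifferentiableAt.mul (by fun_prop) (DifferentiableAt.comp z h h2)

lemma differentiableAt_eta (hz : 0 < z.im) : DifferentiableAt ℂ ModularForm.eta z :=
  ModularForm.differentiableAt_eta_of_mem_upperHalfPlaneSet hz

end

/-! ### Leading terms at infinity -/

/-- `f` has leading term `q ^ s` at infinity. -/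
def HasLeading (f : ℍ → ℂ) (s : ℝ) : Prop :=
  Tendsto (fun τ => f τ / qPow s τ) atImInfty (𝓝 1)

lemma qPow_add (s t : ℝ) (τ : ℍ) : qPow (s + t) τ = qPow s τ * qPow t τ := by
  rw [qPow, qPow, qPow, ← Complex.exp_add]
  congr 1
  push_cast
  ring

lemma qPow_ne_zero (s : ℝ) (τ : ℍ) : qPow s τ ≠ 0 := Complex.exp_ne_zero _

lemma qPow_neg (s : ℝ) (τ : ℍ) : qPow (-s) τ = (qPow s τ)⁻¹ := by
  rw [qPow, qPow, ← Complex.exp_neg]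
  congr 1
  push_cast
  ring

lemma HasLeading.mul {f g : ℍ → ℂ} {s t : ℝ} (hf : HasLeading f s) (hg : HasLeading g t) :
    HasLeading (f * g) (s + t) := by
  have := Tendsto.mul hf hg
  rw [one_mul] at this
  refine this.congr fun τ => ?_
  rw [Pi.mul_apply, qPow_add, mul_div_mul_comm]

lemma HasLeading.inv {f : ℍ → ℂ} {s : ℝ} (hf : HasLeading f s) : HasLeading f⁻¹ (-s) := by
  have := Tendsto.inv₀ hf one_ne_zero
  rw [inv_one] at this
  refine this.congr fun τ => ?_
  rw [Pi.inv_apply, qPow_neg, inv_div_inv, inv_div]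

lemma HasLeading.div {f g : ℍ → ℂ} {s t : ℝ} (hf : HasLeading f s) (hg : HasLeading g t) :
    HasLeading (f / g) (s - t) := by
  rw [div_eq_mul_inv, sub_eq_add_neg]
  exact hf.mul hg.inv

lemma HasLeading.pow {f : ℍ → ℂ} {s : ℝ} (hf : HasLeading f s) :
    ∀ n : ℕ, HasLeading (f ^ n) (n * s)
  | 0 => by
    simp only [HasLeading, pow_zero, Nat.cast_zero, zero_mul, qPow]
    simp
  | n + 1 => by
    rw [pow_succ, Nat.cast_succ, add_mul, one_mul]
    exact (hf.pow n).mul hf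

lemma tendsto_exp_atImInfty {h : ℝ} (hh : 0 < h) :
    Tendsto (fun τ : ℍ => Complex.exp (2 * Real.pi * Complex.I * (h * τ))) atImInfty (𝓝 0) := by
  rw [tendsto_zero_iff_norm_tendsto_zero]
  have im_top : Tendsto UpperHalfPlane.im atImInfty atTop := tendsto_comap
  refine (Real.tendsto_exp_atBot.comp (im_top.const_mul_atTop_of_neg
    (show -(2 * Real.pi * h) < 0 by have := Real.pi_pos; nlinarith [mul_pos this hh]))).congr
    fun τ => ?_
  rw [Complex.norm_exp, Function.comp_apply]
  congr 1
  simp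
  ring

lemma hasLeading_sqrtEta {h : ℝ} (hh : 0 < h) :
    HasLeading (fun τ => sqrtEta (h * τ)) (h / 48) := by
  have h1 : ContinuousAt sqrtEuler 0 := (exists_sqrt_eulerProd.choose_spec.1.differentiableAt
    (Metric.isOpen_ball.mem_nhds (Metric.mem_ball_self one_pos))).continuousAt
  have h2 := h1.tendsto.comp (tendsto_exp_atImInfty hh)
  have h0 : sqrtEuler 0 = 1 := exists_sqrt_eulerProd.choose_spec.2.1
  rw [h0] at h2
  refine h2.congr fun τ => ?_
  change sqrtEuler (Complex.exp (2 * Real.pi * Complex.I * (h * τ))) =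
    sqrtEta (h * τ) / qPow (h / 48) τ
  rw [sqrtEta, mul_div_right_comm, qPow]
  rw [show 2 * (Real.pi : ℂ) * Complex.I * (h * τ) / 48 =
    2 * Real.pi * Complex.I * ((h / 48 : ℝ) : ℂ) * τ by push_cast; ring,
    div_self (Complex.exp_ne_zero _), one_mul]

lemma im_mul_pos {h : ℝ} (hh : 0 < h) (τ : ℍ) : 0 < ((h : ℂ) * (τ : ℂ)).im := by
  rw [Complex.im_ofReal_mul]
  exact mul_pos hh τ.im_pos

lemma hasLeading_eta {h : ℝ} (hh : 0 < h) :
    HasLeading (fun τ => ModularForm.eta (h * τ)) (h / 24) := by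
  have := (hasLeading_sqrtEta hh).pow 2
  rw [show ((2 : ℕ) : ℝ) * (h / 48) = h / 24 by push_cast; ring] at this
  refine this.congr fun τ => ?_
  rw [Pi.pow_apply, sqrtEta_sq (im_mul_pos hh τ)]

lemma mdifferentiable_of_differentiableAt {F : ℂ → ℂ}
    (hF : ∀ z : ℂ, 0 < z.im → DifferentiableAt ℂ F z) :
    MDifferentiable 𝓘(ℂ) 𝓘(ℂ) fun τ : ℍ => F τ := by
  rw [UpperHalfPlane.mdifferentiable_iff]
  refine DifferentiableOn.congr (f := F) (fun z hz => (hF z hz).differentiableWithinAt) fun z hz => ?_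
  simp [ofComplex_apply_of_im_pos hz]

/-! ### The products and their square roots as functions of a complex variable -/

lemma rescale_apply {h : ℝ} (hh : 0 < h) {f : ℍ → ℂ} {F : ℂ → ℂ} (hf : ∀ τ : ℍ, f τ = F τ) (τ : ℍ) :
    rescale h f hh τ = F (h * τ) := by
  rw [rescale, hf]
  rfl

lemma natural_eta_apply (τ : ℍ) : natural eta τ = etaNat τ := by
  simp only [natural, etaNat, Pi.div_apply, Pi.mul_apply, Pi.pow_apply]
  rw [rescale_apply (f := eta) (F := ModularForm.eta) _ (fun _ => rfl),
    rescale_apply (f := eta) (F := ModularForm.eta) _ (fun _ => rfl), eta]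
  rw [show (((1 / 2 : ℝ) : ℝ) : ℂ) * τ = τ / 2 by push_cast; ring, Complex.ofReal_ofNat]

lemma flat_eta_apply (τ : ℍ) : flat eta τ = etaFlat τ := by
  simp only [flat, etaFlat, Pi.div_apply, Pi.pow_apply]
  rw [rescale_apply (f := eta) (F := ModularForm.eta) _ (fun _ => rfl), eta]
  congr 3
  push_cast; ring

lemma sharp_eta_apply (τ : ℍ) : sharp eta τ = etaSharp τ := by
  simp only [sharp, etaSharp, Pi.div_apply, Pi.pow_apply]
  rw [rescale_apply (f := eta) (F := ModularForm.eta) _ (fun _ => rfl), eta]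
  norm_num

lemma prodNatural_apply (τ : ℍ) : prodNatural τ = etaNat (τ / 2) * etaNat (2 * τ) := by
  rw [prodNatural, Pi.mul_apply, rescale_apply _ natural_eta_apply,
    rescale_apply _ natural_eta_apply]
  congr 2
  push_cast; ring

lemma prodFlatSharp_apply (τ : ℍ) : prodFlatSharp τ = etaFlat (τ / 2) * etaSharp (2 * τ) := by
  rw [prodFlatSharp, Pi.mul_apply, rescale_apply _ flat_eta_apply,
    rescale_apply _ sharp_eta_apply]
  congr 2
  push_cast; ring

lemma etaQuarter_apply (c : ℤ) (τ : ℍ) : etaQuarter c τ = etaNat ((τ + c) / 4) := by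
  rw [etaQuarter, translate, rescale_apply _ natural_eta_apply]
  congr 1
  rw [UpperHalfPlane.coe_vadd]
  push_cast
  ring

/-- The square root of `η^♮⟨1/2⟩ η^♮⟨2⟩`. -/
def sqrtNatural (z : ℂ) : ℂ := sqrtEta (z / 2) ^ 5 * sqrtEta (2 * z) ^ 5 /
  (ModularForm.eta (z / 4) * ModularForm.eta z ^ 2 * ModularForm.eta (4 * z))

/-- The square root of `η^♭⟨1/2⟩ η^♯⟨2⟩`. -/
def sqrtFlatSharp (z : ℂ) : ℂ := ModularForm.eta (z / 4) * ModularForm.eta (4 * z) /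
  (sqrtEta (z / 2) * sqrtEta (2 * z))

section

variable {z : ℂ}

lemma im_div_two_pos (hz : 0 < z.im) : 0 < (z / 2).im := by simpa using hz
lemma im_div_four_pos (hz : 0 < z.im) : 0 < (z / 4).im := by simpa using hz
lemma im_two_mul_pos (hz : 0 < z.im) : 0 < (2 * z).im := by simpa using hz
lemma im_four_mul_pos (hz : 0 < z.im) : 0 < (4 * z).im := by simpa using hz

/-- All denominators in the product of the two η^♮ combine to squares; only the fifth powers of
η(z/2) and η(2z) need √η. -/
lemma sqrtNatural_sq (hz : 0 < z.im) : sqrtNatural z ^ 2 = etaNat (z / 2) * etaNat (2 * z) := by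
  have h1 := eta_ne_zero' (im_div_four_pos hz)
  have h2 := eta_ne_zero' (im_four_mul_pos hz)
  have h3 := eta_ne_zero' hz
  have e1 := sqrtEta_sq (im_div_two_pos hz)
  have e2 := sqrtEta_sq (im_two_mul_pos hz)
  rw [sqrtNatural, etaNat, etaNat, ← e1, ← e2, mul_div_cancel₀ z two_ne_zero,
    mul_div_cancel_left₀ z two_ne_zero, show z / 2 / 2 = z / 4 by ring,
    show 2 * (2 * z) = 4 * z by ring]
  field_simp

lemma sqrtFlatSharp_sq (hz : 0 < z.im) :
    sqrtFlatSharp z ^ 2 = etaFlat (z / 2) * etaSharp (2 * z) := by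
  have e1 := sqrtEta_sq (im_div_two_pos hz)
  have e2 := sqrtEta_sq (im_two_mul_pos hz)
  rw [sqrtFlatSharp, etaFlat, etaSharp, ← e1, ← e2, show z / 2 / 2 = z / 4 by ring,
    show 2 * (2 * z) = 4 * z by ring]
  rw [div_pow, mul_pow, mul_pow, div_mul_div_comm]

/-- The cross term in the square of the right-hand side. The squares of the two roots would fix it
only up to sign; the explicit quotients fix the sign. -/
lemma sqrtNatural_mul_sqrtFlatSharp (hz : 0 < z.im) :
    sqrtNatural z * sqrtFlatSharp z = etaFlat z * etaSharp z := by
  have h1 := eta_ne_zero' (im_div_four_pos hz)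
  have h2 := eta_ne_zero' (im_four_mul_pos hz)
  have h3 := eta_ne_zero' hz
  have s1 := sqrtEta_ne_zero (im_div_two_pos hz)
  have s2 := sqrtEta_ne_zero (im_two_mul_pos hz)
  have e1 := sqrtEta_sq (im_div_two_pos hz)
  have e2 := sqrtEta_sq (im_two_mul_pos hz)
  rw [sqrtNatural, sqrtFlatSharp, etaFlat, etaSharp, ← e1, ← e2]
  generalize 2 * z = a at *
  generalize 4 * z = b at *
  field_simp

lemma differentiableAt_sqrtNatural (hz : 0 < z.im) : DifferentiableAt ℂ sqrtNatural z := by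
  have h1 := eta_ne_zero' (im_div_four_pos hz)
  have h2 := eta_ne_zero' (im_four_mul_pos hz)
  have h3 := eta_ne_zero' hz
  have d1 : DifferentiableAt ℂ (fun z => sqrtEta (z / 2)) z :=
    DifferentiableAt.comp (f := fun z => z / 2) z (differentiableAt_sqrtEta (im_div_two_pos hz)) (by fun_prop)
  have d2 : DifferentiableAt ℂ (fun z => sqrtEta (2 * z)) z :=
    DifferentiableAt.comp (f := fun z => 2 * z) z (differentiableAt_sqrtEta (im_two_mul_pos hz)) (by fun_prop)
  have d3 : DifferentiableAt ℂ (fun z => ModularForm.eta (z / 4)) z :=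
    DifferentiableAt.comp (f := fun z => z / 4) z (differentiableAt_eta (im_div_four_pos hz)) (by fun_prop)
  have d4 : DifferentiableAt ℂ (fun z => ModularForm.eta (4 * z)) z :=
    DifferentiableAt.comp (f := fun z => 4 * z) z (differentiableAt_eta (im_four_mul_pos hz)) (by fun_prop)
  exact ((d1.pow 5).mul (d2.pow 5)).div ((d3.mul ((differentiableAt_eta hz).pow 2)).mul d4)
    (mul_ne_zero (mul_ne_zero h1 (pow_ne_zero 2 h3)) h2)

lemma differentiableAt_sqrtFlatSharp (hz : 0 < z.im) : DifferentiableAt ℂ sqrtFlatSharp z := by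
  have d1 : DifferentiableAt ℂ (fun z => sqrtEta (z / 2)) z :=
    DifferentiableAt.comp (f := fun z => z / 2) z (differentiableAt_sqrtEta (im_div_two_pos hz)) (by fun_prop)
  have d2 : DifferentiableAt ℂ (fun z => sqrtEta (2 * z)) z :=
    DifferentiableAt.comp (f := fun z => 2 * z) z (differentiableAt_sqrtEta (im_two_mul_pos hz)) (by fun_prop)
  have d3 : DifferentiableAt ℂ (fun z => ModularForm.eta (z / 4)) z :=
    DifferentiableAt.comp (f := fun z => z / 4) z (differentiableAt_eta (im_div_four_pos hz)) (by fun_prop)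
  have d4 : DifferentiableAt ℂ (fun z => ModularForm.eta (4 * z)) z :=
    DifferentiableAt.comp (f := fun z => 4 * z) z (differentiableAt_eta (im_four_mul_pos hz)) (by fun_prop)
  exact (d3.mul d4).div (d1.mul d2) (mul_ne_zero (sqrtEta_ne_zero (im_div_two_pos hz))
    (sqrtEta_ne_zero (im_two_mul_pos hz)))

end

lemma hasLeading_sqrtNatural : HasLeading (fun τ => sqrtNatural τ) 0 := by
  have a1 := hasLeading_sqrtEta (h := 1 / 2) (by norm_num)
  have a2 := hasLeading_sqrtEta (h := 2) (by norm_num)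
  have b1 := hasLeading_eta (h := 1 / 4) (by norm_num)
  have b2 := hasLeading_eta (h := 1) (by norm_num)
  have b3 := hasLeading_eta (h := 4) (by norm_num)
  have := ((a1.pow 5).mul (a2.pow 5)).div ((b1.mul (b2.pow 2)).mul b3)
  convert this using 1
  · funext τ
    simp only [sqrtNatural, Pi.div_apply, Pi.mul_apply, Pi.pow_apply]
    push_cast
    rw [one_mul, show (τ : ℂ) / 2 = 1 / 2 * τ by ring, show (τ : ℂ) / 4 = 1 / 4 * τ by ring]
  · norm_num

lemma hasLeading_sqrtFlatSharp : HasLeading (fun τ => sqrtFlatSharp τ) (1 / 8) := by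
  have a1 := hasLeading_sqrtEta (h := 1 / 2) (by norm_num)
  have a2 := hasLeading_sqrtEta (h := 2) (by norm_num)
  have b1 := hasLeading_eta (h := 1 / 4) (by norm_num)
  have b3 := hasLeading_eta (h := 4) (by norm_num)
  have := (b1.mul b3).div (a1.mul a2)
  convert this using 1
  · funext τ
    simp only [sqrtFlatSharp, Pi.div_apply, Pi.mul_apply]
    push_cast
    rw [show (τ : ℂ) / 2 = 1 / 2 * τ by ring, show (τ : ℂ) / 4 = 1 / 4 * τ by ring]
  · norm_num

lemma isNormSqrt_sqrtNatural : IsNormSqrt prodNatural fun τ => sqrtNatural τ :=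
  ⟨mdifferentiable_of_differentiableAt fun _ => differentiableAt_sqrtNatural,
    fun τ => by rw [prodNatural_apply, sqrtNatural_sq τ.im_pos], 0, hasLeading_sqrtNatural⟩

lemma isNormSqrt_sqrtFlatSharp : IsNormSqrt prodFlatSharp fun τ => sqrtFlatSharp τ :=
  ⟨mdifferentiable_of_differentiableAt fun _ => differentiableAt_sqrtFlatSharp,
    fun τ => by rw [prodFlatSharp_apply, sqrtFlatSharp_sq τ.im_pos], 1 / 8,
    hasLeading_sqrtFlatSharp⟩

/-! ### The identity between the square roots -/

lemma exp_add_exp_neg_eq_sqrt_two : Complex.exp (2 * Real.pi * Complex.I / 8) +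
    Complex.exp (-(2 * Real.pi * Complex.I / 8)) = ((Real.sqrt 2 : ℝ) : ℂ) := by
  have h := Complex.two_cos ((Real.pi / 4 : ℝ) : ℂ)
  rw [← Complex.ofReal_cos, Real.cos_pi_div_four] at h
  rw [show 2 * (Real.pi : ℂ) * Complex.I / 8 = ((Real.pi / 4 : ℝ) : ℂ) * Complex.I by
    push_cast; ring, ← neg_mul, ← h]
  push_cast
  ring

/-- The dissection at (z + c)/4 gives θ₃(z + c) + θ₂(z + c); the odd translation turns θ₃ into θ₄
and θ₂ into ζ^c θ₂. -/
lemma etaNat_quarter {z : ℂ} (hz : 0 < z.im) (k : ℤ) : etaNat ((z + (2 * k + 1 : ℤ)) / 4) =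
    etaFlat z + 2 * Complex.exp (2 * Real.pi * Complex.I * (2 * k + 1 : ℤ) / 8) * etaSharp z := by
  have hz' : 0 < (z + (2 * k + 1 : ℤ)).im := by rwa [Complex.add_im, Complex.intCast_im, add_zero]
  rw [etaNat_eq (im_div_four_pos hz'), show 4 * ((z + (2 * k + 1 : ℤ)) / 4) = z + (2 * k + 1 : ℤ) by ring, etaNat_add_odd hz,
    etaSharp_add_intCast]
  ring

/-- Write N, s for `etaNat`, `etaSharp` at 2τ and F, S for `etaFlat`, `etaSharp` at τ. The right
side expands to (N + 2s)N + 2(N - 2s)s + 2√2 FS. Here N² - 4s² = F² and Ns = S², so it equals F² +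
2√2 FS + 4S², the product of F + 2ζS and F + 2ζ⁻¹S. -/
lemma prodQuarter_apply (τ : ℍ) : prodQuarter τ =
    (sqrtNatural τ + ((Real.sqrt 2 : ℝ) : ℂ) * sqrtFlatSharp τ) ^ 2 := by
  have hz := τ.im_pos
  have s2 : ((Real.sqrt 2 : ℝ) : ℂ) ^ 2 = 2 := by
    rw [← Complex.ofReal_pow, Real.sq_sqrt zero_le_two, Complex.ofReal_ofNat]
  have r : (sqrtNatural τ + ((Real.sqrt 2 : ℝ) : ℂ) * sqrtFlatSharp τ) ^ 2 =
      sqrtNatural τ ^ 2 + 2 * sqrtFlatSharp τ ^ 2 +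
        2 * ((Real.sqrt 2 : ℝ) : ℂ) * (sqrtNatural τ * sqrtFlatSharp τ) := by
    linear_combination (sqrtFlatSharp τ ^ 2) * s2
  have hz2 := im_div_two_pos hz
  rw [r, sqrtNatural_sq hz, sqrtFlatSharp_sq hz, sqrtNatural_mul_sqrtFlatSharp hz, prodQuarter,
    Pi.mul_apply, etaQuarter_apply, etaQuarter_apply]
  have q1 := etaNat_quarter hz 0
  have q7 := etaNat_quarter hz 3
  norm_num at q1 q7
  push_cast
  rw [q1, q7, etaNat_eq hz2, etaFlat_eq hz2, show 4 * ((τ : ℂ) / 2) = 2 * τ by ring]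
  have f2 := etaFlat_sq hz
  have g2 := etaSharp_sq hz
  have ee := exp_add_exp_neg_eq_sqrt_two
  have e7 : Complex.exp (2 * Real.pi * Complex.I * 7 / 8) =
      Complex.exp (-(2 * Real.pi * Complex.I / 8)) := by
    rw [← Complex.exp_periodic (-(2 * Real.pi * Complex.I / 8))]
    congr 1
    ring
  have e1 : Complex.exp (2 * Real.pi * Complex.I / 8) *
      Complex.exp (-(2 * Real.pi * Complex.I / 8)) = 1 := by
    rw [← Complex.exp_add, add_neg_cancel, Complex.exp_zero]
  rw [e7]
  linear_combination f2 + 4 * g2 + (2 * etaFlat τ * etaSharp τ) * ee + 4 * etaSharp τ ^ 2 * e1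

lemma isNormSqrt_prodQuarter : IsNormSqrt prodQuarter
    fun τ => sqrtNatural τ + ((Real.sqrt 2 : ℝ) : ℂ) * sqrtFlatSharp τ := by
  refine ⟨mdifferentiable_of_differentiableAt
    (F := fun z => sqrtNatural z + ((Real.sqrt 2 : ℝ) : ℂ) * sqrtFlatSharp z) fun z hz =>
    (differentiableAt_sqrtNatural hz).add ((differentiableAt_sqrtFlatSharp hz).const_mul _),
    fun τ => (prodQuarter_apply τ).symm, 0, ?_⟩
  have h1 := hasLeading_sqrtNatural
  -- The second summand is of order q^(1/8), so it vanishes at infinity and the sum keeps the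
  -- leading term 1 of the first.
  have h2 := Tendsto.mul hasLeading_sqrtFlatSharp (tendsto_exp_atImInfty (h := 1 / 8) (by norm_num))
  have h3 := Tendsto.add h1 (h2.const_mul ((Real.sqrt 2 : ℝ) : ℂ))
  rw [mul_zero, mul_zero, add_zero] at h3
  refine h3.congr fun τ => ?_
  have e0 : qPow 0 τ = 1 := by simp [qPow]
  have e8 : Complex.exp (2 * Real.pi * Complex.I * ((1 / 8 : ℝ) * τ)) = qPow (1 / 8) τ := by
    rw [qPow]; congr 1; ring
  rw [e0, e8, div_one, div_one, div_mul_cancel₀ _ (qPow_ne_zero _ _)]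

lemma isNormSqrt_sqrtEta_pow {h : ℝ} (hh : 0 < h) (n : ℕ) :
    IsNormSqrt (rescale h eta hh ^ n) fun τ => sqrtEta (h * τ) ^ n := by
  refine ⟨mdifferentiable_of_differentiableAt (F := fun z => sqrtEta (h * z) ^ n) fun z hz => ?_,
    fun τ => ?_, _, (hasLeading_sqrtEta hh).pow n⟩
  · refine DifferentiableAt.pow ?_ n
    have : 0 < ((h : ℂ) * z).im := im_mul_pos hh ⟨z, hz⟩
    exact (differentiableAt_sqrtEta this).comp z (by fun_prop)
  · rw [Pi.pow_apply, rescale_apply hh (f := eta) (F := ModularForm.eta) (fun _ => rfl),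
      ← sqrtEta_sq (im_mul_pos hh τ)]
    ring

/-! ### Induction over `Γ₀(4)` -/

/-- The matrix `(1 0; 4 1)`. -/
def lowerFour : SL(2, ℤ) := ⟨!![1, 0; 4, 1], by simp [Matrix.det_fin_two]⟩

section entries

variable (γ : SL(2, ℤ))

lemma det_eq_one : γ 0 0 * γ 1 1 - γ 0 1 * γ 1 0 = 1 := by
  have := γ.det_coe
  rwa [Matrix.det_fin_two] at this

lemma mul_entry (γ g : SL(2, ℤ)) (i j : Fin 2) :
    (γ * g) i j = γ i 0 * g 0 j + γ i 1 * g 1 j := by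
  rw [Matrix.SpecialLinearGroup.coe_mul, Matrix.mul_apply, Fin.sum_univ_two]

lemma inv_entry (g : SL(2, ℤ)) : g⁻¹ 0 0 = g 1 1 ∧ g⁻¹ 0 1 = -g 0 1 ∧ g⁻¹ 1 0 = -g 1 0 ∧
    g⁻¹ 1 1 = g 0 0 := by
  rw [Matrix.SpecialLinearGroup.coe_inv, Matrix.adjugate_fin_two]
  exact ⟨rfl, rfl, rfl, rfl⟩

lemma T_entry : ModularGroup.T 0 0 = 1 ∧ ModularGroup.T 0 1 = 1 ∧ ModularGroup.T 1 0 = 0 ∧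
    ModularGroup.T 1 1 = 1 := ⟨rfl, rfl, rfl, rfl⟩

lemma lowerFour_entry : lowerFour 0 0 = 1 ∧ lowerFour 0 1 = 0 ∧ lowerFour 1 0 = 4 ∧
    lowerFour 1 1 = 1 := ⟨rfl, rfl, rfl, rfl⟩

lemma mul_T_apply : (γ * ModularGroup.T) 0 0 = γ 0 0 ∧ (γ * ModularGroup.T) 0 1 = γ 0 0 + γ 0 1 ∧
    (γ * ModularGroup.T) 1 0 = γ 1 0 ∧ (γ * ModularGroup.T) 1 1 = γ 1 0 + γ 1 1 := by
  simp only [mul_entry, T_entry]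
  simp

lemma mul_T_inv_apply : (γ * ModularGroup.T⁻¹) 1 0 = γ 1 0 ∧
    (γ * ModularGroup.T⁻¹) 1 1 = -γ 1 0 + γ 1 1 := by
  simp only [mul_entry, inv_entry, T_entry]
  simp

lemma mul_lowerFour_apply : (γ * lowerFour) 0 0 = γ 0 0 + 4 * γ 0 1 ∧
    (γ * lowerFour) 0 1 = γ 0 1 ∧
    (γ * lowerFour) 1 0 = γ 1 0 + 4 * γ 1 1 ∧ (γ * lowerFour) 1 1 = γ 1 1 := by
  simp only [mul_entry, lowerFour_entry]
  refine ⟨?_, ?_, ?_, ?_⟩ <;> ring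

lemma mul_lowerFour_inv_apply : (γ * lowerFour⁻¹) 1 0 = γ 1 0 - 4 * γ 1 1 ∧
    (γ * lowerFour⁻¹) 1 1 = γ 1 1 := by
  simp only [mul_entry, inv_entry, lowerFour_entry]
  constructor <;> ring

lemma neg_entry (i j : Fin 2) : (-γ) i j = -γ i j := by simp

variable {γ}

lemma odd_of_four_dvd (h : 4 ∣ γ 1 0) : Odd (γ 1 1) := by
  by_contra hd
  rw [Int.not_odd_iff_even] at hd
  have h2 : 2 ∣ γ 0 0 * γ 1 1 - γ 0 1 * γ 1 0 :=
    dvd_sub (hd.two_dvd.mul_left _) (((by norm_num : (2 : ℤ) ∣ 4).trans h).mul_left _)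
  rw [det_eq_one] at h2
  omega

end entries

/-- The matrices -1, T and `lowerFour` generate Γ₀(4), by a Euclidean descent on |c| + |d|. The
equivalences in `hT` and `hU` also give steps by the inverses. -/
theorem four_dvd_induction {P : SL(2, ℤ) → Prop} (h1 : P 1)
    (hneg : ∀ γ : SL(2, ℤ), 4 ∣ γ 1 0 → P γ → P (-γ))
    (hT : ∀ γ : SL(2, ℤ), 4 ∣ γ 1 0 → (P (γ * ModularGroup.T) ↔ P γ))
    (hU : ∀ γ : SL(2, ℤ), 4 ∣ γ 1 0 → (P (γ * lowerFour) ↔ P γ)) :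
    ∀ γ : SL(2, ℤ), 4 ∣ γ 1 0 → P γ := by
  have hT' : ∀ γ : SL(2, ℤ), 4 ∣ γ 1 0 → P (γ * ModularGroup.T⁻¹) → P γ := fun γ h hp => by
    have := (hT (γ * ModularGroup.T⁻¹) (by rwa [(mul_T_inv_apply γ).1])).2 hp
    rwa [inv_mul_cancel_right] at this
  have hU' : ∀ γ : SL(2, ℤ), 4 ∣ γ 1 0 → P (γ * lowerFour⁻¹) → P γ := fun γ h hp => by
    have := (hU (γ * lowerFour⁻¹) (by rw [(mul_lowerFour_inv_apply γ).1]; omega)).2 hp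
    rwa [inv_mul_cancel_right] at this
  have hpow : ∀ n : ℤ, (ModularGroup.T ^ n) 1 0 = 0 ∧ P (ModularGroup.T ^ n) := by
    intro n
    refine ⟨by rw [ModularGroup.coe_T_zpow]; rfl, ?_⟩
    induction n using Int.induction_on with
    | zero => simpa using h1
    | succ n ih =>
      rw [zpow_add_one]
      exact (hT _ (by rw [ModularGroup.coe_T_zpow]; simp)).2 ih
    | pred n ih =>
      refine (hT _ (by rw [ModularGroup.coe_T_zpow]; simp)).1 ?_
      rwa [← zpow_add_one, sub_add_cancel]
  have main : ∀ (n : ℕ) (γ : SL(2, ℤ)), (γ 1 0).natAbs + (γ 1 1).natAbs = n → 4 ∣ γ 1 0 → P γ := by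
    intro n
    induction n using Nat.strong_induction_on with
    | _ n ih =>
      intro γ hn h4
      have hodd := odd_of_four_dvd h4
      rcases eq_or_ne (γ 1 0) 0 with h0 | h0
      · have hdet := det_eq_one γ
        rw [h0, mul_zero, sub_zero] at hdet
        rcases Int.mul_eq_one_iff_eq_one_or_neg_one.1 hdet with ⟨ha, hd⟩ | ⟨ha, hd⟩
        · have : γ = ModularGroup.T ^ (γ 0 1) := by
            ext i j
            rw [ModularGroup.coe_T_zpow]
            fin_cases i <;> fin_cases j <;> simp [ha, hd, h0]
          rw [this]
          exact (hpow _).2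
        · have : γ = -ModularGroup.T ^ (-γ 0 1) := by
            ext i j
            rw [neg_entry, ModularGroup.coe_T_zpow]
            fin_cases i <;> fin_cases j <;> simp [ha, hd, h0]
          rw [this]
          exact hneg _ (by rw [(hpow _).1]; simp) (hpow _).2
      · have hd0 : γ 1 1 ≠ 0 := fun h => by rw [h] at hodd; simp at hodd
        obtain ⟨k, hk⟩ := hodd
        obtain ⟨e1, _, e3, e4⟩ := mul_T_apply γ
        obtain ⟨f3, f4⟩ := mul_T_inv_apply γ
        obtain ⟨_, _, g3, g4⟩ := mul_lowerFour_apply γ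
        obtain ⟨i3, i4⟩ := mul_lowerFour_inv_apply γ
        -- For |c| < 2|d| and c ≠ 0 a step T^±1 shrinks |d|; otherwise `lowerFour`^±1 shrinks |c|.
        -- Equality |c| = 2|d| cannot occur, as 4 divides c and d is odd, so the second descent is
        -- strict as well.
        by_cases hlt : (γ 1 0).natAbs < 2 * (γ 1 1).natAbs
        · by_cases hs : (γ 1 0 < 0 ↔ γ 1 1 < 0)
          · exact hT' γ h4 (ih _ (by rw [f3, f4]; omega) _ rfl (by rwa [f3]))
          · exact (hT γ h4).1 (ih _ (by rw [e3, e4]; omega) _ rfl (by rwa [e3]))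
        · by_cases hs : (γ 1 0 < 0 ↔ γ 1 1 < 0)
          · exact hU' γ h4 (ih _ (by rw [i3, i4]; omega) _ rfl (by rw [i3]; omega))
          · exact (hU γ h4).1 (ih _ (by rw [g3, g4]; omega) _ rfl (by rw [g3]; omega))
  exact fun γ h => main _ γ rfl h

/-- `f (γ τ) = j (γ, τ) f (τ)` for all `τ`. -/
def Transforms (f : ℍ → ℂ) (j : SL(2, ℤ) → ℍ → ℂ) (γ : SL(2, ℤ)) : Prop :=
  ∀ τ, f (γ • τ) = j γ τ * f τ

/-- Only the cocycle relation for right multiplication by one generator is needed, never the full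
cocycle property of j. Evaluating at g⁻¹τ gives the converse without dividing by m. -/
lemma transforms_mul_iff {f : ℍ → ℂ} {j : SL(2, ℤ) → ℍ → ℂ} {γ g : SL(2, ℤ)} {m : ℍ → ℂ}
    (hf : ∀ τ, f (g • τ) = m τ * f τ) (hj : ∀ τ, j (γ * g) τ = j γ (g • τ) * m τ) :
    Transforms f j (γ * g) ↔ Transforms f j γ := by
  constructor
  · intro h τ
    have := h (g⁻¹ • τ)
    rwa [hj, mul_smul, smul_inv_smul, mul_assoc, ← hf, smul_inv_smul] at this
  · intro h τ
    rw [mul_smul, h, hj, hf, mul_assoc]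

lemma coe_T_smul (τ : ℍ) : ((ModularGroup.T • τ : ℍ) : ℂ) = τ + 1 := by
  rw [UpperHalfPlane.modular_T_smul, UpperHalfPlane.coe_vadd]
  push_cast
  ring

lemma coe_SL_smul (γ : SL(2, ℤ)) (τ : ℍ) : ((γ • τ : ℍ) : ℂ) =
    ((γ 0 0 : ℂ) * τ + (γ 0 1 : ℂ)) / ((γ 1 0 : ℂ) * τ + (γ 1 1 : ℂ)) := by
  rw [UpperHalfPlane.coe_specialLinearGroup_apply]
  simp

lemma coe_lowerFour_smul (τ : ℍ) : ((lowerFour • τ : ℍ) : ℂ) = τ / (4 * τ + 1) := by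
  rw [coe_SL_smul]
  simp [lowerFour]

/-! ### Square roots -/

lemma cpow_half_sq (z : ℂ) : (z ^ (1 / 2 : ℂ)) ^ 2 = z := by
  rw [one_div]
  exact Complex.cpow_nat_inv_pow z two_ne_zero

lemma cpow_half_eq_of_sq {s z : ℂ} (hs : 0 < s.re) (h : s ^ 2 = z) : z ^ (1 / 2 : ℂ) = s := by
  rw [one_div, ← h]
  exact Complex.sq_cpow_two_inv hs

lemma re_cpow_half_pos {z : ℂ} (hz : 0 < z.re ∨ z.im ≠ 0) : 0 < (z ^ (1 / 2 : ℂ)).re := by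
  rw [one_div, Complex.cpow_inv_two_re, Real.sqrt_pos]
  rcases hz with h | h
  · have := norm_nonneg z
    linarith
  · have := Complex.abs_re_lt_norm.2 h
    have := neg_abs_le z.re
    linarith

lemma two_mul_re_mul_im (s : ℂ) : (s ^ 2).im = 2 * (s.re * s.im) := by
  rw [sq, Complex.mul_im]; ring

lemma im_cpow_half_pos {z : ℂ} (hz : 0 < z.im) : 0 < (z ^ (1 / 2 : ℂ)).im := by
  have h1 := re_cpow_half_pos (Or.inr hz.ne')
  have h2 := two_mul_re_mul_im (z ^ (1 / 2 : ℂ))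
  rw [cpow_half_sq] at h2
  by_contra h
  nlinarith [mul_nonneg h1.le (neg_nonneg.2 (not_lt.1 h))]

lemma im_cpow_half_nonpos {z : ℂ} (hr : 0 < z.re ∨ z.im ≠ 0) (hz : z.im ≤ 0) :
    (z ^ (1 / 2 : ℂ)).im ≤ 0 := by
  have h1 := re_cpow_half_pos hr
  have h2 := two_mul_re_mul_im (z ^ (1 / 2 : ℂ))
  rw [cpow_half_sq] at h2
  by_contra h
  nlinarith [mul_pos h1 (not_le.1 h)]

lemma cpow_half_ne_zero {z : ℂ} (hz : z ≠ 0) : z ^ (1 / 2 : ℂ) ≠ 0 := fun h => by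
  have := cpow_half_sq z
  rw [h] at this
  exact hz (by rw [← this]; ring)

/-- Both roots lie in the open first quadrant, so their product has positive imaginary part. Its
square has positive imaginary part too, which forces a positive real part, so the product is the
principal root. -/
lemma mul_cpow_half {a b : ℂ} (ha : 0 < a.im) (hb : 0 < b.im) (hab : 0 < (a * b).im) :
    (a * b) ^ (1 / 2 : ℂ) = a ^ (1 / 2 : ℂ) * b ^ (1 / 2 : ℂ) := by
  have hsq : (a ^ (1 / 2 : ℂ) * b ^ (1 / 2 : ℂ)) ^ 2 = a * b := by
    rw [mul_pow, cpow_half_sq, cpow_half_sq]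
  refine cpow_half_eq_of_sq ?_ hsq
  have a1 := re_cpow_half_pos (Or.inr ha.ne')
  have b1 := re_cpow_half_pos (Or.inr hb.ne')
  have a2 := im_cpow_half_pos ha
  have b2 := im_cpow_half_pos hb
  have him : 0 < (a ^ (1 / 2 : ℂ) * b ^ (1 / 2 : ℂ)).im := by
    rw [Complex.mul_im]
    positivity
  have h := two_mul_re_mul_im (a ^ (1 / 2 : ℂ) * b ^ (1 / 2 : ℂ))
  rw [hsq] at h
  by_contra hn
  nlinarith [mul_nonneg (neg_nonneg.2 (not_lt.1 hn)) him.le]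

/-- The two roots lie in the right half plane on opposite sides of the real axis, so their product
stays in the right half plane. -/
lemma mul_cpow_half_of_im_nonpos {a b : ℂ} (ha : 0 < a.re ∨ a.im ≠ 0) (ha' : a.im ≤ 0)
    (hb : 0 < b.im) : (a * b) ^ (1 / 2 : ℂ) = a ^ (1 / 2 : ℂ) * b ^ (1 / 2 : ℂ) := by
  refine cpow_half_eq_of_sq ?_ (by rw [mul_pow, cpow_half_sq, cpow_half_sq])
  have a1 := re_cpow_half_pos ha
  have b1 := re_cpow_half_pos (Or.inr hb.ne')
  have a2 := im_cpow_half_nonpos ha ha'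
  have b2 := im_cpow_half_pos hb
  rw [Complex.mul_re]
  nlinarith [mul_pos a1 b1, mul_nonneg (neg_nonneg.2 a2) b2.le]

lemma ofReal_mul_cpow_half {r : ℝ} (hr : 0 < r) (z : ℂ) :
    ((r : ℂ) * z) ^ (1 / 2 : ℂ) = (r : ℂ) ^ (1 / 2 : ℂ) * z ^ (1 / 2 : ℂ) := by
  rcases eq_or_ne z 0 with rfl | hz
  · simp
  have hr' : (r : ℂ) ≠ 0 := by exact_mod_cast hr.ne'
  rw [Complex.cpow_def_of_ne_zero (mul_ne_zero hr' hz), Complex.cpow_def_of_ne_zero hr',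
    Complex.cpow_def_of_ne_zero hz, Complex.log_ofReal_mul hr hz, ← Complex.exp_add,
    Complex.ofReal_log hr.le, add_mul]

lemma cpow_half_neg {z : ℂ} (hz : 0 < z.im) :
    z ^ (1 / 2 : ℂ) = Complex.I * (-z) ^ (1 / 2 : ℂ) := by
  refine cpow_half_eq_of_sq ?_ (by rw [mul_pow, cpow_half_sq, Complex.I_sq]; ring)
  have h2 := two_mul_re_mul_im ((-z) ^ (1 / 2 : ℂ))
  have h1 := re_cpow_half_pos (z := -z) (Or.inr (by simpa using hz.ne'))
  rw [cpow_half_sq, Complex.neg_im] at h2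
  rw [Complex.I_mul_re]
  by_contra h
  nlinarith [mul_nonneg h1.le (neg_nonpos.1 (not_lt.1 h : _ ≤ (0 : ℝ)))]

/-! ### Inversion -/

/-- The constant in the inversion formula of eta. -/
def invConst : ℂ := (Complex.sqrt Complex.I)⁻¹

lemma invConst_ne_zero : invConst ≠ 0 := by
  refine inv_ne_zero fun h => ?_
  have := cpow_half_sq Complex.I
  rw [one_div] at this
  rw [Complex.sqrt] at h
  rw [h] at this
  exact Complex.I_ne_zero (by rw [← this]; ring)

lemma norm_invConst : ‖invConst‖ = 1 := by
  have := congrArg norm (cpow_half_sq Complex.I)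
  rw [norm_pow, Complex.norm_I, one_div] at this
  rw [invConst, norm_inv, Complex.sqrt, inv_eq_one]
  exact (pow_eq_one_iff_of_nonneg (norm_nonneg _) two_ne_zero).1 this

section

variable {z : ℂ}

lemma im_inv_pos (hz : 0 < z.im) : 0 < (-1 / z).im := by
  rw [neg_div, one_div, Complex.neg_im, Complex.inv_im, neg_div, neg_neg]
  exact div_pos hz (Complex.normSq_pos.2 fun h => by simp [h] at hz)

lemma ne_zero_of_im_pos (hz : 0 < z.im) : z ≠ 0 := fun h => by simp [h] at hz

lemma eta_inv (hz : 0 < z.im) : ModularForm.eta (-1 / z) =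
    invConst * z ^ (1 / 2 : ℂ) * ModularForm.eta z := by
  have := ModularForm.eta_comp_eq_csqrt_I_inv hz
  simp only [Function.comp_apply, Pi.smul_apply, Pi.mul_apply, smul_eq_mul] at this
  rw [this, invConst, one_div, Complex.sqrt, Complex.sqrt, mul_assoc]

lemma eta_inv_mul {r : ℝ} (hr : 0 < r) (hz : 0 < z.im) : ModularForm.eta (r * (-1 / z)) =
    invConst * ((r⁻¹ : ℝ) : ℂ) ^ (1 / 2 : ℂ) * z ^ (1 / 2 : ℂ) * ModularForm.eta (z / r) := by
  have hr' : (r : ℂ) ≠ 0 := by exact_mod_cast hr.ne'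
  have e : (r : ℂ) * (-1 / z) = -1 / (((r⁻¹ : ℝ) : ℂ) * z) := by
    push_cast
    field_simp
  have hz' : 0 < (((r⁻¹ : ℝ) : ℂ) * z).im := by
    rw [Complex.im_ofReal_mul]
    positivity
  rw [e, eta_inv hz', ofReal_mul_cpow_half (inv_pos.2 hr), ← mul_assoc]
  congr 2
  push_cast
  rw [div_eq_inv_mul]

lemma ofReal_cpow_half_sq (r : ℝ) : ((r : ℂ) ^ (1 / 2 : ℂ)) ^ 2 = r := cpow_half_sq _

/-- The factors from η(z/2)² and η(2z)² are 2 and 1/2 and cancel. In `etaFlat_inv` the 2 survives,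
and inversion carries θ₄ to θ₂. -/
lemma etaNat_inv (hz : 0 < z.im) :
    etaNat (-1 / z) = invConst * z ^ (1 / 2 : ℂ) * etaNat z := by
  have h2 := eta_inv_mul (r := 2) two_pos hz
  have h1 := eta_inv_mul (r := 1 / 2) (by norm_num) hz
  have e1 : (((1 / 2 : ℝ) : ℂ)) * (-1 / z) = -1 / z / 2 := by push_cast; ring
  have e2 : z / ((1 / 2 : ℝ) : ℂ) = 2 * z := by push_cast; ring
  have s1 := ofReal_cpow_half_sq (1 / 2 : ℝ)⁻¹
  have s2 := ofReal_cpow_half_sq (2 : ℝ)⁻¹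
  have sz := cpow_half_sq z
  have n1 := invConst_ne_zero
  have n2 := cpow_half_ne_zero (ne_zero_of_im_pos hz)
  have n3 : ((((1 / 2 : ℝ)⁻¹ : ℝ) : ℂ) ^ (1 / 2 : ℂ)) ≠ 0 := cpow_half_ne_zero (by norm_num)
  have n4 : ((((2 : ℝ)⁻¹ : ℝ) : ℂ) ^ (1 / 2 : ℂ)) ≠ 0 := cpow_half_ne_zero (by norm_num)
  rw [e1, e2] at h1
  rw [Complex.ofReal_ofNat] at h2
  rw [etaNat, etaNat, h1, h2, eta_inv hz]
  simp only [mul_pow, s1, s2]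
  push_cast
  have m1 := eta_ne_zero' (im_two_mul_pos hz)
  have m2 := eta_ne_zero' (im_div_two_pos hz)
  generalize 2 * z = a at *
  field_simp

lemma etaFlat_inv (hz : 0 < z.im) :
    etaFlat (-1 / z) = invConst * z ^ (1 / 2 : ℂ) * (2 * etaSharp z) := by
  have h1 := eta_inv_mul (r := 1 / 2) (by norm_num) hz
  have e1 : (((1 / 2 : ℝ) : ℂ)) * (-1 / z) = -1 / z / 2 := by push_cast; ring
  have e2 : z / ((1 / 2 : ℝ) : ℂ) = 2 * z := by push_cast; ring
  have s1 := ofReal_cpow_half_sq (1 / 2 : ℝ)⁻¹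
  have n1 := invConst_ne_zero
  have n2 := cpow_half_ne_zero (ne_zero_of_im_pos hz)
  rw [e1, e2] at h1
  rw [etaFlat, etaSharp, h1, eta_inv hz]
  simp only [mul_pow, s1]
  push_cast
  have m1 := eta_ne_zero' (im_two_mul_pos hz)
  have m2 := eta_ne_zero' hz
  generalize 2 * z = a at *
  field_simp

lemma etaNat_add_two (hz : 0 < z.im) : etaNat (z + 2) = etaNat z := by
  have h1 : 0 < (z + 1).im := by simpa using hz
  have h := etaNat_add_odd h1 0
  have h' := etaFlat_add_odd hz 0
  norm_num at h h'
  rw [← h', ← h, add_assoc]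
  norm_num

end

/-! ### Jacobi symbols -/

/-- Reciprocity makes (a/b) periodic in odd b with period 4|a|. Taking a = c/4, which has the same
symbol as c, gives period |c|. -/
lemma jacobiSym_congr {c : ℤ} (h4 : 4 ∣ c) {b₁ b₂ : ℕ} (h1 : Odd b₁) (h2 : Odd b₂)
    (h : b₁ % c.natAbs = b₂ % c.natAbs) : jacobiSym c b₁ = jacobiSym c b₂ := by
  have hc : c % 4 = 0 := Int.emod_eq_zero_of_dvd h4
  rw [← jacobiSym.div_four_left hc (Nat.odd_iff.1 h1), ← jacobiSym.div_four_left hc (Nat.odd_iff.1 h2),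
    jacobiSym.mod_right _ h1, jacobiSym.mod_right _ h2, show 4 * (c / 4).natAbs = c.natAbs by omega, h]

/-- Modulo |c| - 1 the integer c is congruent to its sign, and |c| - 1 is 3 modulo 4. -/
lemma jacobiSym_natAbs_sub_one {c : ℤ} (h4 : 4 ∣ c) (h0 : c ≠ 0) :
    jacobiSym c (c.natAbs - 1) = if c < 0 then -1 else 1 := by
  have ho : Odd (c.natAbs - 1) := Nat.odd_iff.2 (by omega)
  split_ifs with h
  · rw [jacobiSym.mod_left' (a₂ := -1), jacobiSym.at_neg_one ho, ZMod.χ₄_nat_three_mod_four (by omega)]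
    exact Int.ModEq.symm (Int.modEq_iff_dvd.2 ⟨-1, by omega⟩)
  · rw [jacobiSym.mod_left' (a₂ := 1), jacobiSym.one_left]
    exact Int.ModEq.symm (Int.modEq_iff_dvd.2 ⟨1, by omega⟩)

lemma jacobiSym_sq_of_isCoprime {c : ℤ} {b : ℕ} (h : IsCoprime c b) : jacobiSym c b ^ 2 = 1 :=
  jacobiSym.sq_one (Int.isCoprime_iff_gcd_eq_one.1 h)

/-- Modulo |c| one has b₁b₂ ≡ -b₁² ≡ (|c| - 1) b₁², and the square drops out of the symbol. -/
lemma jacobiSym_reflect {c : ℤ} (h4 : 4 ∣ c) (h0 : c ≠ 0) {b₁ b₂ : ℕ} (h1 : Odd b₁)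
    (hb : b₁ + b₂ = c.natAbs) (hc : IsCoprime c b₁) :
    jacobiSym c b₁ = (if c < 0 then -1 else 1) * jacobiSym c b₂ := by
  obtain ⟨k, hk⟩ := h1
  have h1 : Odd b₁ := ⟨k, hk⟩
  have h2 : Odd b₂ := Nat.odd_iff.2 (by omega)
  have ho : Odd (c.natAbs - 1) := Nat.odd_iff.2 (by omega)
  have n1 : b₁ ≠ 0 := by omega
  have n2 : b₂ ≠ 0 := by have := h2.pos; omega
  have n3 : c.natAbs - 1 ≠ 0 := by omega
  have key : jacobiSym c (b₁ * b₂) = jacobiSym c ((c.natAbs - 1) * (b₁ * b₁)) := by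
    refine jacobiSym_congr h4 (h1.mul h2) (ho.mul (h1.mul h1)) ?_
    refine (Nat.modEq_iff_dvd.2 ⟨b₁ * b₁ - b₁, ?_⟩ : Nat.ModEq c.natAbs _ _)
    rw [← hb]
    push_cast [show 1 ≤ b₁ + b₂ by omega]
    ring
  rw [jacobiSym.mul_right' _ n1 n2, jacobiSym.mul_right' _ n3 (mul_ne_zero n1 n1),
    jacobiSym.mul_right' _ n1 n1, ← sq, jacobiSym_sq_of_isCoprime hc, mul_one,
    jacobiSym_natAbs_sub_one h4 h0] at key
  have hs := jacobiSym_sq_of_isCoprime hc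
  have hc2 : IsCoprime c b₂ := by
    have e : (b₂ : ℤ) = c.natAbs - b₁ := by omega
    rw [e]
    have hd : c ∣ (c.natAbs : ℤ) := Int.dvd_natAbs_self
    obtain ⟨m, hm⟩ := hd
    rw [hm, sub_eq_neg_add]
    exact (hc.neg_right).add_mul_left_right m
  have hs2 := jacobiSym_sq_of_isCoprime hc2
  rw [← key]
  linear_combination (-jacobiSym c b₁) * hs2

/-- If d and c + d have the same sign, their absolute values differ by |c| and periodicity applies.
Otherwise these add up to |c|, and the sign from the reflection is the one built into the Kronecker
convention. -/
lemma kroneckerOdd_add {c d : ℤ} (h4 : 4 ∣ c) (hd : Odd d) (hcd : IsCoprime c d) :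
    kroneckerOdd c (c + d) = kroneckerOdd c d := by
  obtain ⟨k, hk⟩ := hd
  have o1 : Odd d.natAbs := Nat.odd_iff.2 (by omega)
  have o2 : Odd (c + d).natAbs := Nat.odd_iff.2 (by omega)
  have hab : IsCoprime c (d.natAbs : ℤ) := by
    rcases Int.natAbs_eq d with h | h
    · rwa [← h]
    · rw [h] at hcd; exact (IsCoprime.neg_right_iff _ _).1 hcd
  unfold kroneckerOdd
  rcases eq_or_ne c 0 with rfl | h0
  · simp
  by_cases hs : (d < 0 ↔ c + d < 0)
  · have : jacobiSym c (c + d).natAbs = jacobiSym c d.natAbs := by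
      refine jacobiSym_congr h4 o2 o1 ?_
      rcases lt_trichotomy c 0 with hc | hc | hc
      · rcases lt_or_ge d 0 with hd | hd
        · rw [show (c + d).natAbs = d.natAbs + c.natAbs by omega, Nat.add_mod_right]
        · rw [show d.natAbs = (c + d).natAbs + c.natAbs by omega, Nat.add_mod_right]
      · exact absurd hc h0
      · rcases lt_or_ge d 0 with hd | hd
        · rw [show d.natAbs = (c + d).natAbs + c.natAbs by omega, Nat.add_mod_right]
        · rw [show (c + d).natAbs = d.natAbs + c.natAbs by omega, Nat.add_mod_right]
    rw [this]
    simp only [hs]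
  · have := jacobiSym_reflect h4 h0 (b₂ := (c + d).natAbs) o1 (by omega) hab
    rw [this]
    by_cases hc : c < 0
    · have a1 : ¬ (c < 0 ∧ d < 0) := by omega
      have a2 : c < 0 ∧ c + d < 0 := by omega
      rw [if_neg a1, if_pos a2, if_pos hc]
      ring
    · have a1 : ¬ (c < 0 ∧ d < 0) := by omega
      have a2 : ¬ (c < 0 ∧ c + d < 0) := by omega
      rw [if_neg a1, if_neg a2, if_neg hc, one_mul, one_mul]

lemma χ₈_natAbs (d : ℤ) : ZMod.χ₈ (d.natAbs : ℕ) = ZMod.χ₈ (d : ZMod 8) := by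
  rcases Int.natAbs_eq d with h | h
  · conv_rhs => rw [h]
    simp
  · conv_rhs => rw [h]
    rw [Int.cast_neg, Int.cast_natCast]
    generalize ((d.natAbs : ℕ) : ZMod 8) = x
    revert x
    decide

lemma kroneckerOdd_two_mul {c d : ℤ} (hd : Odd d) :
    kroneckerOdd (2 * c) d = ZMod.χ₈ (d : ZMod 8) * kroneckerOdd c d := by
  unfold kroneckerOdd
  obtain ⟨k, hk⟩ := hd
  have o1 : Odd d.natAbs := Nat.odd_iff.2 (by omega)
  rw [jacobiSym.mul_left, jacobiSym.at_two o1, χ₈_natAbs]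
  have : (2 * c < 0 ∧ d < 0) ↔ (c < 0 ∧ d < 0) := by omega
  simp only [this]
  ring

lemma isCoprime_row (γ : SL(2, ℤ)) : IsCoprime (γ 1 0) (γ 1 1) :=
  ⟨-γ 0 1, γ 0 0, by linear_combination det_eq_one γ⟩

/-! ### The theta multiplier -/

/-- The automorphy factor of `Σ q^(n²)` on `Γ₀(4)`. -/
def thetaFactor (γ : SL(2, ℤ)) (τ : ℍ) : ℂ :=
  kroneckerOdd (γ 1 0) (γ 1 1) * sqrtDenom γ τ * (starRingEnd ℂ) (sqrtChi4 (γ 1 1))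

lemma thetaFactor_mul_T {γ : SL(2, ℤ)} (h : 4 ∣ γ 1 0) (τ : ℍ) :
    thetaFactor (γ * ModularGroup.T) τ = thetaFactor γ (ModularGroup.T • τ) := by
  obtain ⟨_, _, e3, e4⟩ := mul_T_apply γ
  rw [thetaFactor, thetaFactor, sqrtDenom, sqrtDenom, e3, e4,
    kroneckerOdd_add h (odd_of_four_dvd h) (isCoprime_row γ), coe_T_smul]
  have e : (γ 1 0 : ℂ) * τ + ((γ 1 0 + γ 1 1 : ℤ) : ℂ) = γ 1 0 * (τ + 1) + γ 1 1 := by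
    push_cast
    ring
  rw [e, sqrtChi4, sqrtChi4, show (γ 1 0 + γ 1 1) % 4 = γ 1 1 % 4 by omega]

/-- The Kronecker sign exactly compensates the branch of the root: √w = ±i √(-w), with the minus
sign when c < 0. This makes `thetaFactor` invariant under γ ↦ -γ. -/
lemma sqrtDenom_neg {γ : SL(2, ℤ)} (hd : γ 1 1 < 0) (τ : ℍ) :
    (if γ 1 0 < 0 ∧ γ 1 1 < 0 then -1 else 1) * sqrtDenom γ τ =
      Complex.I * sqrtDenom (-γ) τ := by
  rw [sqrtDenom, sqrtDenom, neg_entry, neg_entry]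
  have e : ((-γ 1 0 : ℤ) : ℂ) * τ + ((-γ 1 1 : ℤ) : ℂ) =
      -((γ 1 0 : ℂ) * τ + (γ 1 1 : ℂ)) := by push_cast; ring
  have him : ((γ 1 0 : ℂ) * τ + (γ 1 1 : ℂ)).im = γ 1 0 * τ.im := by simp
  rw [e]
  rcases lt_trichotomy (γ 1 0) 0 with hc | hc | hc
  · have hc' : (γ 1 0 : ℝ) < 0 := by exact_mod_cast hc
    have h := cpow_half_neg (z := -((γ 1 0 : ℂ) * τ + (γ 1 1 : ℂ))) (by
      rw [Complex.neg_im, him]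
      nlinarith [τ.im_pos])
    rw [neg_neg] at h
    rw [if_pos ⟨hc, hd⟩, h, ← mul_assoc, Complex.I_mul_I]
  · have hd' : (γ 1 1 : ℝ) < 0 := by exact_mod_cast hd
    have hn : ¬ (γ 1 0 < 0 ∧ γ 1 1 < 0) := by omega
    rw [if_neg hn, one_mul, hc, Int.cast_zero, zero_mul, zero_add]
    have e1 : -(γ 1 1 : ℂ) = ((-(γ 1 1 : ℝ) : ℝ) : ℂ) := by push_cast; rfl
    have e2 : (γ 1 1 : ℂ) = ((-(γ 1 1 : ℝ) : ℝ) : ℂ) * (-1) := by push_cast; ring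
    have e3 : (-1 : ℂ) ^ (1 / 2 : ℂ) = Complex.I := by
      rw [Complex.cpow_def_of_ne_zero (by norm_num), Complex.log_neg_one,
        show (Real.pi : ℂ) * Complex.I * (1 / 2) = Real.pi / 2 * Complex.I by ring,
        Complex.exp_pi_div_two_mul_I]
    rw [e1]
    conv_lhs => rw [e2]
    rw [ofReal_mul_cpow_half (by linarith), e3, mul_comm]
  · have hc' : (0 : ℝ) < γ 1 0 := by exact_mod_cast hc
    have hn : ¬ (γ 1 0 < 0 ∧ γ 1 1 < 0) := by omega
    rw [if_neg hn, one_mul]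
    exact cpow_half_neg (by rw [him]; exact mul_pos hc' τ.im_pos)

lemma thetaFactor_neg_of_neg {γ : SL(2, ℤ)} (hd : γ 1 1 < 0) (ho : Odd (γ 1 1)) (τ : ℍ) :
    thetaFactor γ τ = thetaFactor (-γ) τ := by
  obtain ⟨k, hk⟩ := ho
  have o1 : Odd (γ 1 1).natAbs := Nat.odd_iff.2 (by omega)
  have hs := sqrtDenom_neg hd τ
  have hn : ¬ (-γ 1 0 < 0 ∧ -γ 1 1 < 0) := by omega
  rw [thetaFactor, thetaFactor, neg_entry, neg_entry, kroneckerOdd, kroneckerOdd, if_neg hn,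
    Int.natAbs_neg, jacobiSym.neg _ o1]
  push_cast
  rw [mul_right_comm (if γ 1 0 < 0 ∧ γ 1 1 < 0 then (-1 : ℂ) else 1), hs]
  rcases (by omega : (γ 1 1) % 4 = 1 ∨ (γ 1 1) % 4 = 3) with h | h
  · rw [ZMod.χ₄_nat_three_mod_four (by omega), sqrtChi4, sqrtChi4, if_pos h,
      if_neg (by omega : ¬ (-γ 1 1) % 4 = 1), map_one, Complex.conj_I]
    push_cast
    ring
  · rw [ZMod.χ₄_nat_one_mod_four (by omega), sqrtChi4, sqrtChi4, if_pos (by omega : (-γ 1 1) % 4 = 1),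
      if_neg (by omega : ¬ (γ 1 1) % 4 = 1), map_one, Complex.conj_I]
    linear_combination (-(jacobiSym (γ 1 0) (γ 1 1).natAbs : ℂ) * sqrtDenom (-γ) τ) * Complex.I_mul_I

lemma thetaFactor_neg {γ : SL(2, ℤ)} (h : 4 ∣ γ 1 0) (τ : ℍ) :
    thetaFactor (-γ) τ = thetaFactor γ τ := by
  have ho := odd_of_four_dvd h
  rcases lt_trichotomy (γ 1 1) 0 with hd | hd | hd
  · exact (thetaFactor_neg_of_neg hd ho τ).symm
  · rw [hd] at ho
    simp at ho
  · have := thetaFactor_neg_of_neg (γ := -γ) (by rw [neg_entry]; omega)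
      (by rw [neg_entry]; exact ho.neg) τ
    rwa [neg_neg] at this

/-- For d > 0 the Kronecker sign is absent, and (c + 4d)τ + d lies in the upper half plane whenever
c > 0, so the principal roots multiply. Negative d is reduced to this case through -γ. -/
lemma thetaFactor_mul_lowerFour {γ : SL(2, ℤ)} (hd : 0 < γ 1 1) (τ : ℍ) :
    thetaFactor (γ * lowerFour) τ =
      thetaFactor γ (lowerFour • τ) * (4 * τ + 1 : ℂ) ^ (1 / 2 : ℂ) := by
  obtain ⟨_, _, e3, e4⟩ := mul_lowerFour_apply γ
  have n1 : ¬ (γ 1 0 < 0 ∧ γ 1 1 < 0) := by omega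
  have n2 : ¬ (γ 1 0 + 4 * γ 1 1 < 0 ∧ γ 1 1 < 0) := by omega
  have hk : kroneckerOdd (γ 1 0 + 4 * γ 1 1) (γ 1 1) = kroneckerOdd (γ 1 0) (γ 1 1) := by
    rw [kroneckerOdd, kroneckerOdd, if_neg n1, if_neg n2]
    congr 1
    apply jacobiSym.mod_left'
    rw [Int.natAbs_of_nonneg hd.le]
    exact Int.add_mul_emod_self_right _ _ _
  have hd' : (0 : ℝ) < γ 1 1 := by exact_mod_cast hd
  have hw : 0 < (4 * τ + 1 : ℂ).im := by simpa using τ.im_pos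
  have hw0 := ne_zero_of_im_pos hw
  have hprod : (((γ 1 0 + 4 * γ 1 1 : ℤ) : ℂ) * τ + (γ 1 1 : ℂ)) =
      ((γ 1 0 : ℂ) * (lowerFour • τ : ℍ) + (γ 1 1 : ℂ)) * (4 * τ + 1) := by
    have := div_mul_cancel₀ (τ : ℂ) hw0
    rw [coe_lowerFour_smul]
    push_cast
    linear_combination (-(γ 1 0 : ℂ)) * this
  have hsq : sqrtDenom (γ * lowerFour) τ =
      sqrtDenom γ (lowerFour • τ) * (4 * τ + 1 : ℂ) ^ (1 / 2 : ℂ) := by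
    rw [sqrtDenom, sqrtDenom, e3, e4, hprod]
    have him : ((γ 1 0 : ℂ) * (lowerFour • τ : ℍ) + (γ 1 1 : ℂ)).im =
      γ 1 0 * (lowerFour • τ : ℍ).im := by simp
    have hre : ((γ 1 0 : ℂ) * (lowerFour • τ : ℍ) + (γ 1 1 : ℂ)).re =
      γ 1 0 * (lowerFour • τ : ℍ).re + γ 1 1 := by simp
    have hi := (lowerFour • τ : ℍ).im_pos
    rcases lt_trichotomy (γ 1 0) 0 with hc | hc | hc
    · have hc' : (γ 1 0 : ℝ) < 0 := by exact_mod_cast hc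
      have hneg : (γ 1 0 : ℝ) * (lowerFour • τ : ℍ).im < 0 := mul_neg_of_neg_of_pos hc' hi
      exact mul_cpow_half_of_im_nonpos (Or.inr (by rw [him]; exact hneg.ne))
        (by rw [him]; exact hneg.le) hw
    · refine mul_cpow_half_of_im_nonpos (Or.inl ?_) ?_ hw
      · rw [hre, hc]; simpa using hd
      · rw [him, hc]; simp
    · have hc' : (0 : ℝ) < γ 1 0 := by exact_mod_cast hc
      refine mul_cpow_half (by rw [him]; exact mul_pos hc' hi) hw ?_
      rw [← hprod]
      have : ((((γ 1 0 + 4 * γ 1 1 : ℤ) : ℂ) * τ + (γ 1 1 : ℂ))).im =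
        ((γ 1 0 : ℝ) + 4 * γ 1 1) * τ.im := by simp
      rw [this]
      have := τ.im_pos
      positivity
  rw [thetaFactor, thetaFactor, hsq, e3, e4, hk]
  ring

lemma neg_smul_eq (γ : SL(2, ℤ)) (τ : ℍ) : (-γ) • τ = γ • τ := by
  apply UpperHalfPlane.ext
  rw [coe_SL_smul, coe_SL_smul]
  simp only [neg_entry]
  push_cast
  rw [← neg_div_neg_eq]
  congr 1 <;> ring

/-- The theta function `Σ q^(n²)`, as an eta quotient. -/
def thetaZ (τ : ℍ) : ℂ := etaNat (2 * τ)

lemma thetaZ_T (τ : ℍ) : thetaZ (ModularGroup.T • τ) = thetaZ τ := by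
  rw [thetaZ, thetaZ, coe_T_smul, mul_add, mul_one, etaNat_add_two (im_two_mul_pos τ.im_pos)]

/-- With w twice the image of τ, -1/(2τ) = -1/w + 2. Two inversions and the period 2 of `etaNat`
therefore suffice, and the constant of the inversion cancels. -/
lemma thetaZ_lowerFour (τ : ℍ) : thetaZ (lowerFour • τ) =
    (4 * τ + 1 : ℂ) ^ (1 / 2 : ℂ) * thetaZ τ := by
  rw [thetaZ, thetaZ]
  have h2 := im_two_mul_pos τ.im_pos
  set w : ℂ := 2 * (lowerFour • τ : ℍ) with hw
  have him : 0 < w.im := im_two_mul_pos (lowerFour • τ).im_pos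
  have h4 : 0 < (4 * τ + 1 : ℂ).im := by simpa using τ.im_pos
  have ht := ne_zero_of_im_pos τ.im_pos
  have hw0 := ne_zero_of_im_pos him
  have e1 : w * (4 * τ + 1) = 2 * τ := by
    have := div_mul_cancel₀ (τ : ℂ) (ne_zero_of_im_pos h4)
    rw [hw, coe_lowerFour_smul]
    linear_combination 2 * this
  have e2 : -1 / (2 * τ : ℂ) = -1 / w + 2 := by
    have : 2 * (τ : ℂ) / w = 4 * τ + 1 := by rw [div_eq_iff hw0, ← e1, mul_comm]
    rw [div_eq_iff (mul_ne_zero two_ne_zero ht)]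
    linear_combination this
  have hs := mul_cpow_half him h4 (by rw [e1]; exact h2)
  have a1 := etaNat_inv h2
  rw [e2, etaNat_add_two (im_inv_pos him), etaNat_inv him, ← e1, hs, e1] at a1
  have n1 := invConst_ne_zero
  have n2 := cpow_half_ne_zero hw0
  apply mul_left_cancel₀ (mul_ne_zero n1 n2)
  rw [a1]
  ring

lemma transforms_thetaZ (γ : SL(2, ℤ)) (h : 4 ∣ γ 1 0) : Transforms thetaZ thetaFactor γ := by
  have hneg : ∀ γ : SL(2, ℤ), 4 ∣ γ 1 0 → Transforms thetaZ thetaFactor γ →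
      Transforms thetaZ thetaFactor (-γ) := fun γ h hp τ => by
    rw [neg_smul_eq, thetaFactor_neg h, hp]
  refine four_dvd_induction (P := Transforms thetaZ thetaFactor) ?_ hneg ?_ ?_ γ h
  · intro τ
    simp [thetaFactor, sqrtDenom, kroneckerOdd, sqrtChi4]
  · intro γ h
    exact transforms_mul_iff (m := 1) (fun τ => by rw [thetaZ_T]; simp)
      fun τ => by rw [thetaFactor_mul_T h]; simp
  · intro γ h
    have ho := odd_of_four_dvd h
    rcases lt_trichotomy (γ 1 1) 0 with hd | hd | hd
    · have hiff : ∀ γ : SL(2, ℤ), 4 ∣ γ 1 0 →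
          (Transforms thetaZ thetaFactor γ ↔ Transforms thetaZ thetaFactor (-γ)) := fun γ h =>
        ⟨hneg γ h, fun hp => by
          have := hneg (-γ) (by rw [neg_entry]; exact (dvd_neg).2 h) hp
          rwa [neg_neg] at this⟩
      rw [hiff _ (by rw [(mul_lowerFour_apply γ).2.2.1]; omega), hiff γ h, ← neg_mul]
      exact transforms_mul_iff thetaZ_lowerFour
        (thetaFactor_mul_lowerFour (by rw [neg_entry]; omega))
    · rw [hd] at ho
      simp at ho
    · exact transforms_mul_iff thetaZ_lowerFour (thetaFactor_mul_lowerFour hd)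

/-- Conjugation by diag(2, 1) moves γ to (a, b/2; 2c, d) in Γ₀(4), acting on τ/2. The symbol (2c/d)
= χ₈(d)(c/d) turns the theta multiplier into ξ₈. -/
lemma etaNat_transforms {γ : SL(2, ℤ)} (hb : 2 ∣ γ 0 1) (hc : 2 ∣ γ 1 0) (τ : ℍ) :
    etaNat (γ • τ : ℍ) = J12 γ τ * etaNat τ := by
  obtain ⟨b, hb⟩ := hb
  obtain ⟨c, hc⟩ := hc
  have hdet := det_eq_one γ
  let g : SL(2, ℤ) := ⟨!![γ 0 0, b; 2 * γ 1 0, γ 1 1], by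
    rw [Matrix.det_fin_two_of]; linear_combination hdet + γ 1 0 * hb⟩
  have g00 : g 0 0 = γ 0 0 := rfl
  have g01 : g 0 1 = b := rfl
  have g10 : g 1 0 = 2 * γ 1 0 := rfl
  have g11 : g 1 1 = γ 1 1 := rfl
  have h4 : 4 ∣ g 1 0 := by rw [g10, hc]; exact ⟨c, by ring⟩
  have ho : Odd (γ 1 1) := g11 ▸ odd_of_four_dvd h4
  let σ : ℍ := ⟨τ / 2, im_div_two_pos τ.im_pos⟩
  have hσ : (σ : ℂ) = τ / 2 := rfl
  have h := transforms_thetaZ g h4 σ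
  have hden : ((2 * γ 1 0 : ℤ) : ℂ) * (τ / 2) + (γ 1 1 : ℂ) = (γ 1 0 : ℂ) * τ + (γ 1 1 : ℂ) := by
    push_cast; ring
  have e1 : 2 * ((g • σ : ℍ) : ℂ) = (γ • τ : ℍ) := by
    rw [coe_SL_smul, coe_SL_smul, g00, g01, g10, g11, hσ, hden, hb]
    push_cast
    ring
  rw [thetaZ, thetaZ, e1, hσ, mul_div_cancel₀ _ two_ne_zero, thetaFactor, sqrtDenom, g10, g11, hσ,
    hden, kroneckerOdd_two_mul ho] at h
  rw [h, J12, sqrtDenom, xi8]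
  push_cast
  ring

/-! ### Modular units of weight zero -/

/-- The root of unity `exp (2 π i m / 32)`. -/
def e32 (m : ℤ) : ℂ := Complex.exp (2 * Real.pi * Complex.I * m / 32)

lemma e32_add (m n : ℤ) : e32 (m + n) = e32 m * e32 n := by
  rw [e32, e32, e32, ← Complex.exp_add]
  congr 1
  push_cast
  ring

lemma e32_zero : e32 0 = 1 := by simp [e32]

lemma e32_congr {m n : ℤ} (h : 32 ∣ m - n) : e32 m = e32 n := by
  obtain ⟨k, hk⟩ := h
  rw [show m = n + 32 * k by omega, e32_add]
  have : e32 (32 * k) = 1 := by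
    rw [e32, Complex.exp_eq_one_iff]
    exact ⟨k, by push_cast; ring⟩
  rw [this, mul_one]

lemma e32_sixteen : e32 16 = -1 := by
  rw [e32, ← Complex.exp_pi_mul_I]
  congr 1
  push_cast
  ring

/-- `η(2τ)³ / (η(4τ) η(τ)²)`. -/
def unitV (z : ℂ) : ℂ :=
  ModularForm.eta (2 * z) ^ 3 / (ModularForm.eta (4 * z) * ModularForm.eta z ^ 2)

/-- `η(τ/2)³ / (η(τ/4) η(τ)²)`. -/
def unitW (z : ℂ) : ℂ :=
  ModularForm.eta (z / 2) ^ 3 / (ModularForm.eta (z / 4) * ModularForm.eta z ^ 2)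

/-- `η(4τ) / η(τ)`. -/
def unitX (z : ℂ) : ℂ := ModularForm.eta (4 * z) / ModularForm.eta z

/-- `η(τ/4) / η(τ)`. -/
def unitY (z : ℂ) : ℂ := ModularForm.eta (z / 4) / ModularForm.eta z

lemma unitV_add_one (z : ℂ) : unitV (z + 1) = unitV z := by
  have h2 : 2 * (z + 1) = 2 * z + (2 : ℤ) := by push_cast; ring
  have h4 : 4 * (z + 1) = 4 * z + (4 : ℤ) := by push_cast; ring
  have h1 : z + 1 = z + (1 : ℤ) := by push_cast; ring
  rw [unitV, unitV, h2, h4, h1, eta_add_intCast, eta_add_intCast, eta_add_intCast, mul_pow, mul_pow,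
    mul_mul_mul_comm, mul_div_mul_comm, ← Complex.exp_nat_mul, ← Complex.exp_nat_mul,
    ← Complex.exp_add, ← Complex.exp_sub]
  convert one_mul _
  rw [Complex.exp_eq_one_iff]
  exact ⟨0, by push_cast; ring⟩

lemma unitX_add_one (z : ℂ) : unitX (z + 1) = e32 4 * unitX z := by
  have h4 : 4 * (z + 1) = 4 * z + (4 : ℤ) := by push_cast; ring
  have h1 : z + 1 = z + (1 : ℤ) := by push_cast; ring
  rw [unitX, unitX, h4, h1, eta_add_intCast, eta_add_intCast, mul_div_mul_comm,
    ← Complex.exp_sub, e32]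
  congr 2
  push_cast
  ring

lemma unitW_sub_four (z : ℂ) : unitW (z - 4) = e32 4 * unitW z := by
  have h2 : (z - 4) / 2 = z / 2 + (-2 : ℤ) := by push_cast; ring
  have h4 : (z - 4) / 4 = z / 4 + (-1 : ℤ) := by push_cast; ring
  have h1 : z - 4 = z + (-4 : ℤ) := by push_cast; ring
  rw [unitW, unitW, h2, h4, h1, eta_add_intCast, eta_add_intCast, eta_add_intCast, mul_pow, mul_pow,
    mul_mul_mul_comm, mul_div_mul_comm, ← Complex.exp_nat_mul, ← Complex.exp_nat_mul,
    ← Complex.exp_add, ← Complex.exp_sub, e32]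
  congr 2
  push_cast
  ring

lemma unitY_sub_four (z : ℂ) : unitY (z - 4) = e32 4 * unitY z := by
  have h4 : (z - 4) / 4 = z / 4 + (-1 : ℤ) := by push_cast; ring
  have h1 : z - 4 = z + (-4 : ℤ) := by push_cast; ring
  rw [unitY, unitY, h4, h1, eta_add_intCast, eta_add_intCast, mul_div_mul_comm,
    ← Complex.exp_sub, e32]
  congr 2
  push_cast
  ring

lemma ofReal_cpow_half_ne_zero {r : ℝ} (hr : 0 < r) : (r : ℂ) ^ (1 / 2 : ℂ) ≠ 0 :=
  cpow_half_ne_zero (by exact_mod_cast hr.ne')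

/-- In weight zero the root of z and the constant of the eta inversion cancel. The value of k is
irrelevant, since it occurs on both sides wherever the relation is used. -/
lemma exists_unitX_inv : ∃ k : ℂ, k ≠ 0 ∧ ∀ z : ℂ, 0 < z.im → unitX (-1 / z) = k * unitY z := by
  refine ⟨(((4 : ℝ)⁻¹ : ℝ) : ℂ) ^ (1 / 2 : ℂ), ofReal_cpow_half_ne_zero (by norm_num),
    fun z hz => ?_⟩
  have h4 := eta_inv_mul (r := 4) four_pos hz
  rw [Complex.ofReal_ofNat] at h4
  have n1 := invConst_ne_zero
  have n2 := cpow_half_ne_zero (ne_zero_of_im_pos hz)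
  have n3 := eta_ne_zero' hz
  rw [unitX, unitY, h4, eta_inv hz]
  field_simp

lemma exists_unitV_inv : ∃ k : ℂ, k ≠ 0 ∧ ∀ z : ℂ, 0 < z.im → unitV (-1 / z) = k * unitW z := by
  have c2 := ofReal_cpow_half_ne_zero (r := (2 : ℝ)⁻¹) (by norm_num)
  have c4 := ofReal_cpow_half_ne_zero (r := (4 : ℝ)⁻¹) (by norm_num)
  refine ⟨((((2 : ℝ)⁻¹ : ℝ) : ℂ) ^ (1 / 2 : ℂ)) ^ 3 / (((4 : ℝ)⁻¹ : ℝ) : ℂ) ^ (1 / 2 : ℂ),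
    div_ne_zero (pow_ne_zero 3 c2) c4, fun z hz => ?_⟩
  have h2 := eta_inv_mul (r := 2) two_pos hz
  have h4 := eta_inv_mul (r := 4) four_pos hz
  rw [Complex.ofReal_ofNat] at h2 h4
  have n1 := invConst_ne_zero
  have n2 := cpow_half_ne_zero (ne_zero_of_im_pos hz)
  have n3 := eta_ne_zero' hz
  have n4 := eta_ne_zero' (im_div_four_pos hz)
  rw [unitV, unitW, h2, h4, eta_inv hz]
  generalize (((2 : ℝ)⁻¹ : ℝ) : ℂ) ^ (1 / 2 : ℂ) = s at *
  generalize (((4 : ℝ)⁻¹ : ℝ) : ℂ) ^ (1 / 2 : ℂ) = t at *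
  generalize z ^ (1 / 2 : ℂ) = u at *
  field_simp

lemma im_sub_four_pos {z : ℂ} (hz : 0 < z.im) : 0 < (z - 4).im := by simpa using hz

lemma neg_one_div_neg_one_div (z : ℂ) : -1 / (-1 / z) = z := by
  rw [div_div_eq_mul_div, neg_one_mul, neg_div_neg_eq, div_one]

/-- `lowerFour` is translation by -4 conjugated by the inversion. -/
lemma lowerFour_smul_of_inv {F G : ℂ → ℂ} {k e : ℂ}
    (hinv : ∀ z : ℂ, 0 < z.im → F (-1 / z) = k * G z) (hG : ∀ z : ℂ, G (z - 4) = e * G z) (τ : ℍ) :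
    F (lowerFour • τ : ℍ) = e * F τ := by
  have hi := im_inv_pos τ.im_pos
  have ht := ne_zero_of_im_pos τ.im_pos
  have e1 : ((lowerFour • τ : ℍ) : ℂ) = -1 / (-1 / τ - 4) := by
    rw [coe_lowerFour_smul, show (-1 / (τ : ℂ) - 4) = -(4 * τ + 1) / τ by field_simp; ring,
      div_div_eq_mul_div, neg_one_mul, neg_div_neg_eq]
  rw [e1, hinv _ (im_sub_four_pos hi), hG]
  conv_rhs => rw [← neg_one_div_neg_one_div (τ : ℂ), hinv _ hi]
  ring

lemma coe_S_smul (τ : ℍ) : ((ModularGroup.S • τ : ℍ) : ℂ) = -1 / τ := by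
  rw [coe_SL_smul]
  simp [ModularGroup.S]

lemma S_entry : ModularGroup.S 0 0 = 0 ∧ ModularGroup.S 0 1 = -1 ∧ ModularGroup.S 1 0 = 1 ∧
    ModularGroup.S 1 1 = 0 := ⟨rfl, rfl, rfl, rfl⟩

lemma S_conj_entry (γ : SL(2, ℤ)) : let g := ModularGroup.S * γ * ModularGroup.S⁻¹
    g 0 0 = γ 1 1 ∧ g 0 1 = -γ 1 0 ∧ g 1 0 = -γ 0 1 ∧ g 1 1 = γ 0 0 := by
  simp only [mul_entry, inv_entry, S_entry]
  simp

lemma transforms_of_inv {F G : ℂ → ℂ} {k : ℂ} (hk : k ≠ 0)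
    (hinv : ∀ z : ℂ, 0 < z.im → F (-1 / z) = k * G z) {ψ : SL(2, ℤ) → ℂ}
    (hF : ∀ γ : SL(2, ℤ), 4 ∣ γ 1 0 → ∀ τ : ℍ, F (γ • τ : ℍ) = ψ γ * F τ)
    {γ : SL(2, ℤ)} (h : 4 ∣ γ 0 1) (τ : ℍ) :
    G (γ • τ : ℍ) = ψ (ModularGroup.S * γ * ModularGroup.S⁻¹) * G τ := by
  have h1 := hF (ModularGroup.S * γ * ModularGroup.S⁻¹)
    (by rw [(S_conj_entry γ).2.2.1]; exact (dvd_neg).2 h) (ModularGroup.S • τ)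
  rw [mul_smul, inv_smul_smul, mul_smul, coe_S_smul, coe_S_smul, hinv _ (γ • τ).im_pos,
    hinv _ τ.im_pos] at h1
  apply mul_left_cancel₀ hk
  rw [h1]
  ring

lemma unitX_transforms (γ : SL(2, ℤ)) (h : 4 ∣ γ 1 0) (τ : ℍ) : unitX (γ • τ : ℍ) =
    e32 (4 * (γ 0 1 * γ 1 1) + γ 1 0 * γ 1 1) * unitX τ := by
  refine four_dvd_induction (P := Transforms (fun τ : ℍ => unitX τ)
    fun γ _ => e32 (4 * (γ 0 1 * γ 1 1) + γ 1 0 * γ 1 1)) ?_ ?_ ?_ ?_ γ h τ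
  · intro τ
    simp [e32_zero]
  · intro γ _ hp τ
    have := hp τ
    simp only [neg_smul_eq, neg_entry, neg_mul_neg]
    exact this
  · intro γ h
    refine transforms_mul_iff (m := fun _ => e32 4)
      (fun τ => by rw [coe_T_smul, unitX_add_one]) fun τ => ?_
    obtain ⟨_, e2, e3, e4⟩ := mul_T_apply γ
    rw [e2, e3, e4, ← e32_add]
    apply e32_congr
    obtain ⟨c, hc⟩ := h
    have hdet := det_eq_one γ
    have ho := odd_of_four_dvd ⟨c, hc⟩
    -- With lower left entry 4c, the exponent at γT exceeds that at γ by 4 + 16c(a + c) + 32bc.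
    -- Since a is odd, c(a + c) is even and only the 4 remains modulo 32.
    have hpar : Even (c * (γ 0 0 + c)) := by
      have ha : Odd (γ 0 0) := by
        by_contra ha
        rw [Int.not_odd_iff_even] at ha
        have h2 : 2 ∣ γ 0 0 * γ 1 1 - γ 0 1 * γ 1 0 :=
          dvd_sub (ha.two_dvd.mul_right _) (by rw [hc]; exact ⟨γ 0 1 * (2 * c), by ring⟩)
        rw [hdet] at h2
        omega
      rcases Int.even_or_odd c with hc | hc
      · exact hc.mul_right _
      · exact (ha.add_odd hc).mul_left _
    obtain ⟨m, hm⟩ := hpar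
    refine ⟨m + γ 0 1 * c, ?_⟩
    rw [hc] at hdet ⊢
    linear_combination 4 * hdet + 16 * hm
  · intro γ h
    obtain ⟨k, _, hk⟩ := exists_unitX_inv
    refine transforms_mul_iff (m := fun _ => e32 4)
      (lowerFour_smul_of_inv hk unitY_sub_four) fun τ => ?_
    obtain ⟨_, e2, e3, e4⟩ := mul_lowerFour_apply γ
    rw [e2, e3, e4, ← e32_add]
    apply e32_congr
    -- The exponent grows by 4d², which is 4 modulo 32 for odd d.
    have h8 := Int.eight_dvd_sq_sub_one_of_odd (odd_of_four_dvd h)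
    obtain ⟨m, hm⟩ := h8
    exact ⟨m, by linear_combination 4 * hm⟩

lemma χ₈_add_four (x : ZMod 8) : ZMod.χ₈ (x + 4) = -ZMod.χ₈ x := by
  revert x
  decide

lemma χ₈_neg (x : ZMod 8) : ZMod.χ₈ (-x) = ZMod.χ₈ x := by
  revert x
  decide

lemma χ₈_four_mul_add (c d : ℤ) : (ZMod.χ₈ ((4 * c + d : ℤ) : ZMod 8) : ℂ) * e32 (16 * c ^ 2) =
    ZMod.χ₈ (d : ZMod 8) := by
  rcases Int.even_or_odd' c with ⟨m, h | h⟩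
  · rw [e32_congr (n := 0) ⟨2 * m ^ 2, by rw [h]; ring⟩, e32_zero, mul_one]
    have : ((4 * c + d : ℤ) : ZMod 8) = d := by
      rw [h]
      push_cast
      have : (4 * (2 * (m : ZMod 8))) = 0 := by
        rw [← mul_assoc, show (4 * 2 : ZMod 8) = 0 from rfl, zero_mul]
      rw [this, zero_add]
    rw [this]
  · rw [e32_congr (n := 16) ⟨2 * m ^ 2 + 2 * m, by rw [h]; ring⟩, e32_sixteen]
    have : ((4 * c + d : ℤ) : ZMod 8) = d + 4 := by
      rw [h]
      push_cast
      have : (4 * (2 * (m : ZMod 8))) = 0 := by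
        rw [← mul_assoc, show (4 * 2 : ZMod 8) = 0 from rfl, zero_mul]
      linear_combination this
    rw [this, χ₈_add_four]
    push_cast
    ring

/-- T fixes V but increases the exponent cd by c². As 4 divides c, this costs the sign (-1)^(c/4),
which χ₈(c + d) = (-1)^(c/4) χ₈(d) repairs. -/
lemma unitV_transforms (γ : SL(2, ℤ)) (h : 4 ∣ γ 1 0) (τ : ℍ) : unitV (γ • τ : ℍ) =
    ((ZMod.χ₈ (γ 1 1 : ZMod 8) : ℤ) : ℂ) * e32 (γ 1 0 * γ 1 1) * unitV τ := by
  refine four_dvd_induction (P := Transforms (fun τ : ℍ => unitV τ)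
    fun γ _ => ((ZMod.χ₈ (γ 1 1 : ZMod 8) : ℤ) : ℂ) * e32 (γ 1 0 * γ 1 1)) ?_ ?_ ?_ ?_ γ h τ
  · intro τ
    simp [e32_zero]
  · intro γ _ hp τ
    have := hp τ
    simp only [neg_smul_eq, neg_entry, neg_mul_neg, Int.cast_neg, χ₈_neg]
    exact this
  · intro γ h
    refine transforms_mul_iff (m := fun _ => 1)
      (fun τ => by rw [coe_T_smul, unitV_add_one, one_mul]) fun τ => ?_
    obtain ⟨_, e2, e3, e4⟩ := mul_T_apply γ
    obtain ⟨c, hc⟩ := h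
    have he : e32 (4 * c * (4 * c + γ 1 1)) = e32 (16 * c ^ 2) * e32 (4 * c * γ 1 1) := by
      rw [← e32_add]
      congr 1
      ring
    rw [e3, e4, hc, mul_one, ← χ₈_four_mul_add c (γ 1 1), he]
    ring
  · intro γ h
    obtain ⟨k, _, hk⟩ := exists_unitV_inv
    refine transforms_mul_iff (m := fun _ => e32 4)
      (lowerFour_smul_of_inv hk unitW_sub_four) fun τ => ?_
    obtain ⟨_, e2, e3, e4⟩ := mul_lowerFour_apply γ
    rw [e3, e4, mul_assoc, ← e32_add]
    congr 1
    apply e32_congr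
    have h8 := Int.eight_dvd_sq_sub_one_of_odd (odd_of_four_dvd h)
    obtain ⟨m, hm⟩ := h8
    exact ⟨m, by linear_combination 4 * hm⟩

lemma unitY_transforms {γ : SL(2, ℤ)} (h : 4 ∣ γ 0 1) (τ : ℍ) : unitY (γ • τ : ℍ) =
    e32 (-(4 * (γ 1 0 * γ 0 0)) - γ 0 1 * γ 0 0) * unitY τ := by
  obtain ⟨k, hk0, hk⟩ := exists_unitX_inv
  rw [transforms_of_inv hk0 hk unitX_transforms h τ]
  obtain ⟨_, e2, e3, e4⟩ := S_conj_entry γ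
  rw [e2, e3, e4]
  congr 2
  ring

lemma unitW_transforms {γ : SL(2, ℤ)} (h : 4 ∣ γ 0 1) (τ : ℍ) : unitW (γ • τ : ℍ) =
    ((ZMod.χ₈ (γ 0 0 : ZMod 8) : ℤ) : ℂ) * e32 (-(γ 0 1 * γ 0 0)) * unitW τ := by
  obtain ⟨k, hk0, hk⟩ := exists_unitV_inv
  rw [transforms_of_inv hk0 hk unitV_transforms h τ]
  obtain ⟨_, e2, e3, e4⟩ := S_conj_entry γ
  rw [e3, e4, neg_mul]

section

variable {γ : SL(2, ℤ)}

lemma mul_eq_one_zmod (hγ : γ ∈ Gam 4) : (γ 0 0 : ZMod 8) * (γ 1 1 : ZMod 8) = 1 := by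
  obtain ⟨⟨c, hc⟩, ⟨b, hb⟩⟩ := hγ
  have hdet := congrArg (Int.cast : ℤ → ZMod 8) (det_eq_one γ)
  rw [hb, hc] at hdet
  push_cast at hdet
  have : (4 * (b : ZMod 8) * (4 * (c : ZMod 8))) = 0 := by
    rw [mul_mul_mul_comm, show (4 * 4 : ZMod 8) = 0 from rfl, zero_mul]
  linear_combination hdet + this

lemma eight_dvd_sub (hγ : γ ∈ Gam 4) : 8 ∣ γ 1 1 - γ 0 0 := by
  have h := mul_eq_one_zmod hγ
  have : (γ 1 1 : ZMod 8) = (γ 0 0 : ZMod 8) := by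
    generalize (γ 0 0 : ZMod 8) = x at *
    generalize (γ 1 1 : ZMod 8) = y at *
    revert x y
    decide
  exact (ZMod.intCast_eq_intCast_iff_dvd_sub _ _ 8).1 this.symm

/-- The values of χ₈ at a and d cancel because ad ≡ 1 modulo 8. As 4 divides b and 8 divides d - a,
ab may be replaced by bd modulo 32. -/
lemma unitV_mul_unitW_transforms (hγ : γ ∈ Gam 4) (τ : ℍ) :
    unitV (γ • τ : ℍ) * unitW (γ • τ : ℍ) =
      e32 (γ 1 0 * γ 1 1 - γ 0 1 * γ 1 1) * (unitV τ * unitW τ) := by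
  obtain ⟨m, hm⟩ := eight_dvd_sub hγ
  have hχ : ((ZMod.χ₈ (γ 1 1 : ZMod 8) : ℤ) : ℂ) * ((ZMod.χ₈ (γ 0 0 : ZMod 8) : ℤ) : ℂ) = 1 := by
    rw [← Int.cast_mul, ← map_mul, mul_comm, mul_eq_one_zmod hγ, map_one, Int.cast_one]
  rw [unitV_transforms γ hγ.1, unitW_transforms hγ.2]
  have he : e32 (γ 1 0 * γ 1 1 - γ 0 1 * γ 1 1) =
      e32 (γ 1 0 * γ 1 1) * e32 (-(γ 0 1 * γ 0 0)) := by
    rw [← e32_add]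
    apply e32_congr
    obtain ⟨b, hb⟩ := hγ.2
    exact ⟨-(b * m), by rw [hb]; push_cast; linear_combination (-4 * b) * hm⟩
  rw [he]
  linear_combination (e32 (γ 1 0 * γ 1 1) * e32 (-(γ 0 1 * γ 0 0)) * unitV τ * unitW τ) * hχ

lemma unitX_mul_unitY_transforms (hγ : γ ∈ Gam 4) (τ : ℍ) :
    unitX (γ • τ : ℍ) * unitY (γ • τ : ℍ) =
      e32 (3 * (γ 0 1 * γ 1 1) - 3 * (γ 1 0 * γ 1 1)) * (unitX τ * unitY τ) := by
  obtain ⟨m, hm⟩ := eight_dvd_sub hγ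
  rw [unitX_transforms γ hγ.1, unitY_transforms hγ.2, mul_mul_mul_comm, ← e32_add]
  congr 1
  apply e32_congr
  obtain ⟨b, hb⟩ := hγ.2
  obtain ⟨c, hc⟩ := hγ.1
  refine ⟨4 * c * m + b * m, ?_⟩
  rw [hb, hc]
  push_cast
  linear_combination (4 * b + 16 * c) * hm

end

/-! ### The automorphy factors -/

lemma formSqrt_eq {f g : ℍ → ℂ} (h : IsNormSqrt f g) : formSqrt f = g :=
  (isNormSqrt_formSqrt h).unique h

lemma formSqrt_eta_cube (τ : ℍ) : formSqrt (eta ^ 3) τ = sqrtEta τ ^ 3 := by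
  have h1 : rescale 1 eta = eta := by
    funext τ
    rw [rescale_apply (f := eta) (F := ModularForm.eta) _ (fun _ => rfl), Complex.ofReal_one,
      one_mul, eta]
  have := formSqrt_eq (isNormSqrt_sqrtEta_pow one_pos 3)
  rw [h1] at this
  rw [this]
  change sqrtEta (((1 : ℝ) : ℂ) * τ) ^ 3 = _
  rw [Complex.ofReal_one, one_mul]

lemma formSqrt_rescale_half (τ : ℍ) :
    formSqrt (rescale (1 / 2) eta ^ 3) τ = sqrtEta (τ / 2) ^ 3 := by
  rw [formSqrt_eq (isNormSqrt_sqrtEta_pow _ 3)]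
  change sqrtEta (((1 / 2 : ℝ) : ℂ) * τ) ^ 3 = _
  rw [show (((1 / 2 : ℝ) : ℂ) * τ) = τ / 2 by push_cast; ring]

lemma formSqrt_rescale_two (τ : ℍ) :
    formSqrt (rescale 2 eta ^ 3) τ = sqrtEta (2 * τ) ^ 3 := by
  rw [formSqrt_eq (isNormSqrt_sqrtEta_pow _ 3), Complex.ofReal_ofNat]

/-- `√η(τ/2)³ √η(2τ)³ / √η(τ)⁶`. -/
def unitR (z : ℂ) : ℂ := sqrtEta (z / 2) ^ 3 * sqrtEta (2 * z) ^ 3 / sqrtEta z ^ 6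

/-- R is the combination of cubes of √η occurring in the weight. With η^♮ taken out as well, what
remains is an integral eta quotient of weight zero; `sqrtFlatSharp_eq` has the same shape. -/
lemma sqrtNatural_eq {z : ℂ} (hz : 0 < z.im) :
    sqrtNatural z = unitR z * etaNat z * (unitV z * unitW z) := by
  have h1 := eta_ne_zero' (im_div_four_pos hz)
  have h2 := eta_ne_zero' (im_four_mul_pos hz)
  have h3 := sqrtEta_ne_zero hz
  have h4 := sqrtEta_ne_zero (im_two_mul_pos hz)
  have h5 := sqrtEta_ne_zero (im_div_two_pos hz)
  have e0 := sqrtEta_sq hz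
  have e1 := sqrtEta_sq (im_div_two_pos hz)
  have e2 := sqrtEta_sq (im_two_mul_pos hz)
  rw [sqrtNatural, unitR, etaNat, unitV, unitW, ← e0, ← e1, ← e2]
  generalize 2 * z = a at *
  generalize 4 * z = b at *
  field_simp

lemma sqrtFlatSharp_eq {z : ℂ} (hz : 0 < z.im) :
    sqrtFlatSharp z = unitR z * etaNat z * (unitX z * unitY z) := by
  have h3 := sqrtEta_ne_zero hz
  have h4 := sqrtEta_ne_zero (im_two_mul_pos hz)
  have h5 := sqrtEta_ne_zero (im_div_two_pos hz)
  have e0 := sqrtEta_sq hz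
  have e1 := sqrtEta_sq (im_div_two_pos hz)
  have e2 := sqrtEta_sq (im_two_mul_pos hz)
  rw [sqrtFlatSharp, unitR, etaNat, unitX, unitY, ← e0, ← e1, ← e2]
  generalize 2 * z = a at *
  generalize 4 * z = b at *
  field_simp

lemma chi16_mul_conj {d : ℤ} (hd : Odd d) : chi16 d * (starRingEnd ℂ) (chi16 d) = 1 := by
  obtain ⟨k, hk⟩ := hd
  unfold chi16
  split_ifs
  · simp
  · simp
  · simp
  · simp
  · omega

lemma cChar_eq_e32 (γ : SL(2, ℤ)) : cChar 32 γ = e32 (-(γ 1 0 * γ 1 1)) ∧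
    cChar 16 γ = e32 (-(2 * (γ 1 0 * γ 1 1))) ∧ cChar 8 γ = e32 (-(4 * (γ 1 0 * γ 1 1))) := by
  refine ⟨?_, ?_, ?_⟩ <;>
  · rw [cChar, e32]
    congr 1
    push_cast
    ring

lemma bChar_eq_e32 (γ : SL(2, ℤ)) : bChar 32 γ = e32 (γ 0 1 * γ 1 1) ∧
    bChar 16 γ = e32 (2 * (γ 0 1 * γ 1 1)) ∧ bChar 8 γ = e32 (4 * (γ 0 1 * γ 1 1)) := by
  refine ⟨?_, ?_, ?_⟩ <;>
  · rw [bChar, e32]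
    congr 1
    push_cast
    ring

lemma e32_ne_zero (m : ℤ) : e32 m ≠ 0 := Complex.exp_ne_zero _

/-- Unfolding the definitions, the factors of weight a/2 and A/2 multiply to R(γτ)/R(τ) divided by
characters. There χ₁₆ cancels its conjugate, c₈c₃₂/c₁₆² = c₃₂ and b₃₂b₈/b₁₆² = b₃₂. -/
lemma J12aA_mul_unitR {γ : SL(2, ℤ)} (hd : Odd (γ 1 1)) (τ : ℍ) :
    J12aA γ τ * e32 (γ 0 1 * γ 1 1 - γ 1 0 * γ 1 1) * unitR τ =
      J12 γ τ * unitR (γ • τ : ℍ) := by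
  obtain ⟨c32, c16, c8⟩ := cChar_eq_e32 γ
  obtain ⟨b32, b16, b8⟩ := bChar_eq_e32 γ
  have hχ := chi16_mul_conj hd
  have s16 : e32 (-(2 * (γ 1 0 * γ 1 1))) ^ 2 = e32 (-(4 * (γ 1 0 * γ 1 1))) := by
    rw [sq, ← e32_add]; congr 1; ring
  have t16 : e32 (2 * (γ 0 1 * γ 1 1)) ^ 2 = e32 (4 * (γ 0 1 * γ 1 1)) := by
    rw [sq, ← e32_add]; congr 1; ring
  rw [sub_eq_add_neg, e32_add, J12aA, Ja, JA, J34, J34a, J34A, formSqrt_eta_cube, formSqrt_eta_cube,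
    formSqrt_rescale_half, formSqrt_rescale_half, formSqrt_rescale_two, formSqrt_rescale_two,
    c32, c16, c8, b32, b16, b8, ← s16, ← t16, unitR, unitR]
  have n1 := e32_ne_zero (-(2 * (γ 1 0 * γ 1 1)))
  have n2 := e32_ne_zero (2 * (γ 0 1 * γ 1 1))
  have n3 := e32_ne_zero (-(γ 1 0 * γ 1 1))
  have n4 := e32_ne_zero (γ 0 1 * γ 1 1)
  have n5 := left_ne_zero_of_mul (hχ.trans_ne one_ne_zero)
  have n6 := right_ne_zero_of_mul (hχ.trans_ne one_ne_zero)
  have m1 := sqrtEta_ne_zero τ.im_pos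
  have m2 := sqrtEta_ne_zero (im_two_mul_pos τ.im_pos)
  have m3 := sqrtEta_ne_zero (im_div_two_pos τ.im_pos)
  have m4 := sqrtEta_ne_zero (γ • τ).im_pos
  generalize 2 * (τ : ℂ) = a at *
  generalize 2 * ((γ • τ : ℍ) : ℂ) = b at *
  generalize e32 (-(2 * (γ 1 0 * γ 1 1))) = x1 at *
  generalize e32 (2 * (γ 0 1 * γ 1 1)) = x2 at *
  generalize e32 (-(γ 1 0 * γ 1 1)) = x3 at *
  generalize e32 (γ 0 1 * γ 1 1) = x4 at *
  generalize (starRingEnd ℂ) (chi16 (γ 1 1)) = y at *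
  generalize chi16 (γ 1 1) = y' at *
  have hy : y = y'⁻¹ := eq_inv_of_mul_eq_one_right hχ
  subst hy
  field_simp

/-- The multiplier of VW is the inverse of the c₃₂b₃₂ left over from R, so the character is trivial.
For `sqrtFlatSharp` that of XY is (c₃₂b₃₂)³, and the total is (c₃₂b₃₂)⁴ = c₈b₈. -/
lemma sqrtNatural_transforms {γ : SL(2, ℤ)} (hγ : γ ∈ Gam 4) (τ : ℍ) :
    sqrtNatural (γ • τ : ℍ) = J12aA γ τ * sqrtNatural τ := by
  have two4 : (2 : ℤ) ∣ (4 : ℕ) := by norm_num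
  rw [sqrtNatural_eq τ.im_pos, sqrtNatural_eq (γ • τ).im_pos, unitV_mul_unitW_transforms hγ,
    etaNat_transforms (two4.trans hγ.2) (two4.trans hγ.1)]
  have h := J12aA_mul_unitR (odd_of_four_dvd hγ.1) τ
  have he : e32 (γ 0 1 * γ 1 1 - γ 1 0 * γ 1 1) * e32 (γ 1 0 * γ 1 1 - γ 0 1 * γ 1 1) = 1 := by
    rw [← e32_add, ← e32_zero]; congr 1; ring
  linear_combination
    (-etaNat τ * unitV τ * unitW τ * e32 (γ 1 0 * γ 1 1 - γ 0 1 * γ 1 1)) * h +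
    (J12aA γ τ * unitR τ * etaNat τ * unitV τ * unitW τ) * he

lemma sqrtFlatSharp_transforms {γ : SL(2, ℤ)} (hγ : γ ∈ Gam 4) (τ : ℍ) :
    sqrtFlatSharp (γ • τ : ℍ) = c8b8 γ * J12aA γ τ * sqrtFlatSharp τ := by
  have two4 : (2 : ℤ) ∣ (4 : ℕ) := by norm_num
  rw [sqrtFlatSharp_eq τ.im_pos, sqrtFlatSharp_eq (γ • τ).im_pos, unitX_mul_unitY_transforms hγ,
    etaNat_transforms (two4.trans hγ.2) (two4.trans hγ.1)]
  have h := J12aA_mul_unitR (odd_of_four_dvd hγ.1) τ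
  have he : e32 (γ 0 1 * γ 1 1 - γ 1 0 * γ 1 1) *
      e32 (3 * (γ 0 1 * γ 1 1) - 3 * (γ 1 0 * γ 1 1)) = c8b8 γ := by
    rw [c8b8, (cChar_eq_e32 γ).2.2, (bChar_eq_e32 γ).2.2, ← e32_add, ← e32_add]; congr 1; ring
  linear_combination
    (-etaNat τ * unitX τ * unitY τ * e32 (3 * (γ 0 1 * γ 1 1) - 3 * (γ 1 0 * γ 1 1))) * h +
    (J12aA γ τ * unitR τ * etaNat τ * unitX τ * unitY τ) * he

/-! ### Growth at the cusps -/

/-- The sum of the absolute values of the three theta constants. -/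
def thetaBound (z : ℂ) : ℝ := ‖2 * etaSharp z‖ + ‖etaNat z‖ + ‖etaFlat z‖

section

variable {z : ℂ}

lemma norm_cpow_half_sq (z : ℂ) : ‖z ^ (1 / 2 : ℂ)‖ ^ 2 = ‖z‖ := by
  rw [← norm_pow, cpow_half_sq]

lemma thetaBound_add_one (hz : 0 < z.im) : thetaBound (z + 1) = thetaBound z := by
  have h1 := etaNat_add_odd hz 0
  have h2 := etaFlat_add_odd hz 0
  have h3 := etaSharp_add_intCast z 1
  have h4 : ‖Complex.exp (2 * Real.pi * Complex.I * (1 : ℤ) / 8)‖ = 1 := by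
    rw [show 2 * (Real.pi : ℂ) * Complex.I * (1 : ℤ) / 8 = ((Real.pi / 4 : ℝ) : ℂ) * Complex.I by
      push_cast; ring, Complex.norm_exp_ofReal_mul_I]
  simp only [mul_zero, zero_add, Int.cast_one] at h1 h2 h3 h4
  rw [thetaBound, thetaBound, h1, h2, h3, norm_mul, norm_mul, norm_mul, h4]
  ring

lemma thetaBound_inv (hz : 0 < z.im) :
    thetaBound (-1 / z) = ‖z ^ (1 / 2 : ℂ)‖ * thetaBound z := by
  -- The inversion of θ₂ is obtained from that of θ₄ at -1/z, with |√z| |√(-1/z)| = 1.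
  have h := etaFlat_inv (im_inv_pos hz)
  rw [neg_one_div_neg_one_div] at h
  have hn := congrArg norm h
  rw [norm_mul, norm_mul, norm_invConst, one_mul] at hn
  have hp : ‖z ^ (1 / 2 : ℂ)‖ * ‖(-1 / z) ^ (1 / 2 : ℂ)‖ = 1 := by
    refine (pow_eq_one_iff_of_nonneg (by positivity) two_ne_zero).1 ?_
    rw [mul_pow, norm_cpow_half_sq, norm_cpow_half_sq, ← norm_mul,
      mul_div_cancel₀ _ (ne_zero_of_im_pos hz), norm_neg, norm_one]
  rw [thetaBound, thetaBound, etaNat_inv hz, etaFlat_inv hz, norm_mul, norm_mul (_ * _),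
    norm_mul invConst, norm_invConst, one_mul, norm_mul (_ * _), norm_mul invConst, norm_invConst,
    one_mul, hn, ← norm_mul]
  linear_combination (-‖2 * etaSharp (-1 / z)‖) * hp

end

lemma sqrtDenom_sq (γ : SL(2, ℤ)) (τ : ℍ) :
    sqrtDenom γ τ ^ 2 = (γ 1 0 : ℂ) * τ + (γ 1 1 : ℂ) := cpow_half_sq _

lemma denom_ne_zero' (γ : SL(2, ℤ)) (τ : ℍ) : (γ 1 0 : ℂ) * τ + (γ 1 1 : ℂ) ≠ 0 := by
  have := UpperHalfPlane.denom_ne_zero (γ : GL (Fin 2) ℝ) τ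
  simpa [UpperHalfPlane.denom] using this

lemma sqrtDenom_ne_zero (γ : SL(2, ℤ)) (τ : ℍ) : sqrtDenom γ τ ≠ 0 :=
  cpow_half_ne_zero (denom_ne_zero' γ τ)

lemma norm_sqrtDenom_mul (γ g : SL(2, ℤ)) (τ : ℍ) :
    ‖sqrtDenom (γ * g) τ‖ = ‖sqrtDenom γ (g • τ)‖ * ‖sqrtDenom g τ‖ := by
  refine (pow_left_inj₀ (norm_nonneg _) (by positivity) two_ne_zero).1 ?_
  rw [mul_pow, ← norm_pow, ← norm_pow, ← norm_pow, sqrtDenom_sq, sqrtDenom_sq, sqrtDenom_sq,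
    ← norm_mul]
  congr 1
  have := denom_ne_zero' g τ
  rw [coe_SL_smul, mul_entry, mul_entry, add_mul, mul_assoc, div_mul_cancel₀ _ this]
  push_cast
  ring

/-- T interchanges |θ₃| and |θ₄|; S fixes θ₃ and interchanges θ₂ and θ₄ up to the common factor. In
absolute value the factor is a genuine cocycle, so the generators S and T suffice. -/
lemma thetaBound_smul (γ : SL(2, ℤ)) (τ : ℍ) :
    thetaBound (γ • τ : ℍ) = ‖sqrtDenom γ τ‖ * thetaBound τ := by
  have hone : ∀ τ : ℍ, sqrtDenom 1 τ = 1 := fun τ => by simp [sqrtDenom]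
  have hmem : γ ∈ Subgroup.closure {ModularGroup.S, ModularGroup.T} := by
    rw [SpecialLinearGroup.SL2Z_generators]
    trivial
  induction hmem using Subgroup.closure_induction generalizing τ with
  | mem g hg =>
    rcases hg with rfl | rfl
    · rw [coe_S_smul, thetaBound_inv τ.im_pos, sqrtDenom]
      simp [ModularGroup.S]
    · rw [coe_T_smul, thetaBound_add_one τ.im_pos, sqrtDenom]
      simp [ModularGroup.T]
  | one => rw [one_smul, hone, norm_one, one_mul]
  | mul g h _ _ hg hh => rw [mul_smul, hg, hh, norm_sqrtDenom_mul, mul_assoc]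
  | inv g _ hg =>
    have h1 := hg (g⁻¹ • τ)
    rw [smul_inv_smul] at h1
    have h2 := norm_sqrtDenom_mul g g⁻¹ τ
    rw [mul_inv_cancel, hone, norm_one] at h2
    rw [h1]
    linear_combination thetaBound (g⁻¹ • τ : ℍ) * h2

lemma hasLeading_etaNat : HasLeading (fun τ => etaNat τ) 0 := by
  have b1 := hasLeading_eta (h := 1 / 2) (by norm_num)
  have b2 := hasLeading_eta (h := 1) (by norm_num)
  have b3 := hasLeading_eta (h := 2) (by norm_num)
  convert (b2.pow 5).div ((b1.pow 2).mul (b3.pow 2)) using 1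
  · funext τ
    simp only [etaNat, Pi.div_apply, Pi.mul_apply, Pi.pow_apply]
    push_cast
    rw [one_mul, show (τ : ℂ) / 2 = 1 / 2 * τ by ring]
  · norm_num

lemma hasLeading_etaFlat : HasLeading (fun τ => etaFlat τ) 0 := by
  have b1 := hasLeading_eta (h := 1 / 2) (by norm_num)
  have b2 := hasLeading_eta (h := 1) (by norm_num)
  convert (b1.pow 2).div b2 using 1
  · funext τ
    simp only [etaFlat, Pi.div_apply, Pi.pow_apply]
    push_cast
    rw [one_mul, show (τ : ℂ) / 2 = 1 / 2 * τ by ring]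
  · norm_num

lemma hasLeading_etaSharp : HasLeading (fun τ => etaSharp τ) (1 / 8) := by
  have b2 := hasLeading_eta (h := 1) (by norm_num)
  have b3 := hasLeading_eta (h := 2) (by norm_num)
  convert (b3.pow 2).div b2 using 1
  · funext τ
    simp only [etaSharp, Pi.div_apply, Pi.pow_apply]
    push_cast
    rw [one_mul]
  · norm_num

lemma HasLeading.tendsto_one {f : ℍ → ℂ} (hf : HasLeading f 0) : Tendsto f atImInfty (𝓝 1) :=
  hf.congr fun τ => by simp [qPow]

lemma HasLeading.tendsto_zero {f : ℍ → ℂ} {s : ℝ} (hf : HasLeading f s) (hs : 0 < s) :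
    Tendsto f atImInfty (𝓝 0) := by
  have := Tendsto.mul hf (tendsto_exp_atImInfty hs)
  rw [mul_zero] at this
  refine this.congr fun τ => ?_
  have e : Complex.exp (2 * Real.pi * Complex.I * (s * τ)) = qPow s τ := by
    rw [qPow]; congr 1; ring
  rw [e, div_mul_cancel₀ _ (qPow_ne_zero _ _)]

lemma tendsto_thetaBound : Tendsto (fun τ : ℍ => thetaBound τ) atImInfty (𝓝 2) := by
  have h1 := ((hasLeading_etaSharp.tendsto_zero (by norm_num)).const_mul 2).norm
  have h := (h1.add hasLeading_etaNat.tendsto_one.norm).add hasLeading_etaFlat.tendsto_one.norm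
  rw [mul_zero, norm_zero, norm_one, zero_add, one_add_one_eq_two] at h
  exact h

lemma isBoundedAtImInfty_of_norm_le {f : ℍ → ℂ} {C : ℝ} (hC : 0 ≤ C)
    (hf : ∀ τ : ℍ, ‖f τ‖ ≤ C * thetaBound τ) (α : SL(2, ℤ)) :
    IsBoundedAtImInfty fun τ : ℍ => f (α • τ) / sqrtDenom α τ := by
  rw [isBoundedAtImInfty_iff]
  -- Any constant above the limit 2 would do.
  have h3 : ∀ᶠ τ : ℍ in atImInfty, thetaBound τ < 3 :=
    tendsto_thetaBound.eventually (gt_mem_nhds (by norm_num))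
  obtain ⟨A, hA⟩ := (atImInfty_mem _).1 h3
  refine ⟨C * 3, A, fun τ hτ => ?_⟩
  have hn : 0 < ‖sqrtDenom α τ‖ := norm_pos_iff.2 (sqrtDenom_ne_zero α τ)
  rw [norm_div, div_le_iff₀ hn]
  refine (hf _).trans ?_
  rw [thetaBound_smul, mul_comm ‖_‖, ← mul_assoc]
  have : thetaBound τ ≤ 3 := (show thetaBound τ < 3 from hA τ hτ).le
  gcongr

section

variable {z : ℂ}

/-- Fourth powers are compared because the duplication formulas control the squares of the theta
constants at z/2 and 2z by those at z. -/
lemma norm_le_thetaBound_of_sq {x u v : ℂ} (h : x ^ 2 = u * v)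
    (hu : ‖u ^ 2‖ ≤ thetaBound z ^ 2) (hv : ‖v ^ 2‖ ≤ thetaBound z ^ 2) : ‖x‖ ≤ thetaBound z := by
  have hb : 0 ≤ thetaBound z := by unfold thetaBound; positivity
  refine le_of_pow_le_pow_left₀ four_ne_zero hb ?_
  calc ‖x‖ ^ 4 = ‖u ^ 2‖ * ‖v ^ 2‖ := by
        rw [← norm_pow, ← norm_mul, ← mul_pow, ← h]; congr 1; ring
    _ ≤ thetaBound z ^ 2 * thetaBound z ^ 2 := by gcongr
    _ = thetaBound z ^ 4 := by ring

lemma norm_etaNat_half_sq_le (hz : 0 < z.im) : ‖etaNat (z / 2) ^ 2‖ ≤ thetaBound z ^ 2 := by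
  rw [etaNat_sq (im_div_two_pos hz), mul_div_cancel₀ _ two_ne_zero]
  refine (norm_add_le _ _).trans ?_
  rw [norm_pow, norm_pow, thetaBound]
  have h1 := norm_nonneg (2 * etaSharp z)
  have h2 := norm_nonneg (etaNat z)
  have h3 := norm_nonneg (etaFlat z)
  nlinarith [mul_nonneg h1 h2, mul_nonneg h1 h3, mul_nonneg h2 h3]

lemma norm_etaFlat_half_sq_le (hz : 0 < z.im) : ‖etaFlat (z / 2) ^ 2‖ ≤ thetaBound z ^ 2 := by
  rw [etaFlat_sq (im_div_two_pos hz), mul_div_cancel₀ _ two_ne_zero]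
  refine (norm_sub_le _ _).trans ?_
  rw [norm_pow, norm_pow, thetaBound]
  have h1 := norm_nonneg (2 * etaSharp z)
  have h2 := norm_nonneg (etaNat z)
  have h3 := norm_nonneg (etaFlat z)
  nlinarith [mul_nonneg h1 h2, mul_nonneg h1 h3, mul_nonneg h2 h3]

lemma norm_etaNat_two_mul_sq_le (hz : 0 < z.im) : ‖etaNat (2 * z) ^ 2‖ ≤ thetaBound z ^ 2 := by
  have e : etaNat (2 * z) ^ 2 = (etaNat z ^ 2 + etaFlat z ^ 2) / 2 := by
    linear_combination (-1 / 2) * etaNat_sq hz + (-1 / 2) * etaFlat_sq hz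
  rw [e, norm_div, Complex.norm_ofNat, div_le_iff₀ two_pos]
  refine (norm_add_le _ _).trans ?_
  rw [norm_pow, norm_pow, thetaBound]
  have h1 := norm_nonneg (2 * etaSharp z)
  have h2 := norm_nonneg (etaNat z)
  have h3 := norm_nonneg (etaFlat z)
  nlinarith [mul_nonneg h1 h2, mul_nonneg h1 h3, mul_nonneg h2 h3]

lemma norm_etaSharp_two_mul_sq_le (hz : 0 < z.im) : ‖etaSharp (2 * z) ^ 2‖ ≤ thetaBound z ^ 2 := by
  have e : etaSharp (2 * z) ^ 2 = (etaNat z ^ 2 - etaFlat z ^ 2) / 8 := by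
    linear_combination (-1 / 8) * etaNat_sq hz + (1 / 8) * etaFlat_sq hz
  rw [e, norm_div, Complex.norm_ofNat, div_le_iff₀ (by norm_num)]
  refine (norm_sub_le _ _).trans ?_
  rw [norm_pow, norm_pow, thetaBound]
  have h1 := norm_nonneg (2 * etaSharp z)
  have h2 := norm_nonneg (etaNat z)
  have h3 := norm_nonneg (etaFlat z)
  nlinarith [mul_nonneg h1 h2, mul_nonneg h1 h3, mul_nonneg h2 h3]

lemma norm_sqrtNatural_le (hz : 0 < z.im) : ‖sqrtNatural z‖ ≤ thetaBound z :=
  norm_le_thetaBound_of_sq (sqrtNatural_sq hz) (norm_etaNat_half_sq_le hz)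
    (norm_etaNat_two_mul_sq_le hz)

lemma norm_sqrtFlatSharp_le (hz : 0 < z.im) : ‖sqrtFlatSharp z‖ ≤ thetaBound z :=
  norm_le_thetaBound_of_sq (sqrtFlatSharp_sq hz) (norm_etaFlat_half_sq_le hz)
    (norm_etaSharp_two_mul_sq_le hz)

end

/-! ### The modular forms of the proposition -/

lemma isForm_sqrtNatural : IsForm (Gam 4) 1 fun τ => sqrtNatural τ :=
  ⟨isNormSqrt_sqrtNatural.1, fun γ hγ τ => by
      rw [Pi.one_apply, one_mul]; exact sqrtNatural_transforms hγ τ,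
    isBoundedAtImInfty_of_norm_le zero_le_one fun τ => by
      rw [one_mul]; exact norm_sqrtNatural_le τ.im_pos⟩

lemma isForm_sqrtFlatSharp : IsForm (Gam 4) c8b8 fun τ => sqrtFlatSharp τ :=
  ⟨isNormSqrt_sqrtFlatSharp.1, fun γ hγ τ => sqrtFlatSharp_transforms hγ τ,
    isBoundedAtImInfty_of_norm_le zero_le_one fun τ => by
      rw [one_mul]; exact norm_sqrtFlatSharp_le τ.im_pos⟩

lemma isForm_sqrtQuarter : IsForm {γ ∈ Gam 4 | c8b8 γ = 1} 1
    fun τ => sqrtNatural τ + ((Real.sqrt 2 : ℝ) : ℂ) * sqrtFlatSharp τ := by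
  refine ⟨isNormSqrt_prodQuarter.1, ?_, isBoundedAtImInfty_of_norm_le
    (f := fun τ : ℍ => sqrtNatural τ + ((Real.sqrt 2 : ℝ) : ℂ) * sqrtFlatSharp τ)
    (C := 1 + Real.sqrt 2) (by positivity) fun τ => ?_⟩
  · rintro γ ⟨hγ, h1⟩ τ
    beta_reduce
    rw [sqrtNatural_transforms hγ, sqrtFlatSharp_transforms hγ, h1, Pi.one_apply]
    ring
  · refine (norm_add_le _ _).trans ?_
    rw [norm_mul, Complex.norm_real, Real.norm_of_nonneg (Real.sqrt_nonneg 2), add_mul, one_mul]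
    gcongr
    · exact norm_sqrtNatural_le τ.im_pos
    · exact norm_sqrtFlatSharp_le τ.im_pos

end EtaForms

end

theorem mainTheorem12 :
    IsNormSqrt prodQuarter (formSqrt prodQuarter) ∧
    IsNormSqrt prodNatural (formSqrt prodNatural) ∧
    IsNormSqrt prodFlatSharp (formSqrt prodFlatSharp) ∧
    formSqrt prodQuarter =
      formSqrt prodNatural + ((Real.sqrt 2 : ℝ) : ℂ) • formSqrt prodFlatSharp ∧
    IsForm (Gam 4) 1 (formSqrt prodNatural) ∧
    IsForm (Gam 4) c8b8 (formSqrt prodFlatSharp) ∧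
    IsForm {γ ∈ Gam 4 | c8b8 γ = 1} 1 (formSqrt prodQuarter) := by
  -- Uniqueness of normalized roots replaces each root by its explicit form; the root of the first
  -- product is the sum itself, so the identity becomes definitional.
  rw [formSqrt_eq isNormSqrt_prodQuarter, formSqrt_eq isNormSqrt_sqrtNatural,
    formSqrt_eq isNormSqrt_sqrtFlatSharp]
  exact ⟨isNormSqrt_prodQuarter, isNormSqrt_sqrtNatural, isNormSqrt_sqrtFlatSharp, rfl,
    isForm_sqrtNatural, isForm_sqrtFlatSharp, isForm_sqrtQuarter⟩
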